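/- **Theorem (Mesoscopic correlation functions).** Let $T_c>0$, $\beta>0$, $\epsilon\in\mathbb R$. On $(\mathbb C^2)^{\otimes N}$ let $S^N_i=\frac12\sum_{k=1}^N\sigma_i^{(k)}$ ($i=x,y,z$, Pauli matrices), $S^N_\pm=S^N_x\pm iS^N_y$, $H^N=-2\epsilon S^N_z-\frac{2T_c}{N}S^N_+S^N_-$ (the strong-coupling BCS Hamiltonian), and let $\rho^N_\beta=e^{-\beta H^N}/\mathrm{Tr}\,e^{-\beta H^N}$ be the Gibbs state. Let $\Delta>0$ be the modulus of a non-vanishing gap, i.e. a positive solution of $$\frac{\omega}{T_c}=\tanh(\beta\omega),\qquad \omega=\sqrt{\epsilon^2+4T_c^2\Delta^2}.$$ For each $N$ let $(b_i)$ be an orthonormal basis of $(\mathbb C^2)^{\otimes N}$ consisting of joint eigenvectors of $(\vec S^N)^2$ and $S^N_z$; these are eigenvectors of $\rho^N_\beta$, with eigenvalues $r_i$, say. Let $|\Omega^N_\beta\rangle=\sum_i\sqrt{r_i}\;b_i\otimes b_i$ be the purified Gibbs (GNS) vector in the doubled space. Then $$\mathfrak c^2:=\lim_{N\to\infty}\frac1{N^2}\mathrm{Tr}\big[\rho^N_\beta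 S^N_+S^N_-\big]=\Delta^2 ,\qquad\text{i.e. } \mathfrak c=\Delta .$$ Put $p^N=S^N_z\otimes\mathbb I-\mathbb I\otimes S^N_z$, $E^N_\pm=\dfrac{S^N_\pm\otimes\mathbb I}{\mathfrak cN}$, and write products from left to right in order of increasing $j$. Let $\mathcal C$ be the Heisenberg algebra on the circle: the $C^*$-algebra of operators on $L^2([0,2\pi])$ generated by $(e^{i\alpha\hat p}\psi)(\varphi)=\psi(\varphi+\alpha)$ ($\alpha\in\mathbb R$, $\psi$ extended periodically) and $(e^{ik\hat\varphi}\psi)(\varphi)=e^{ik\varphi}\psi(\varphi)$ ($k\in\mathbb Z$). Then there is exactly one state $\Omega$ on $\mathcal C$ such that for all $r\ge0$, $\alpha_j\in\mathbb R$ and $m_j,n_j\in\mathbb N$ (possibly zero), $1\le j\le r$, $$\lim_{N\to\infty}\Big\langle\Omega^N_\beta\Big|\prod_{j=1}^r e^{i\alpha_jp^N}(E^N_-)^{n_j}(E^N_+)^{m_j}\Big|\Omega^N_\beta\Big\rangle=\Omega\Big(\prod_{j=1}^r e^{i\alpha_j\hat p}e^{i(m_j-n_j)\hat\varphi}\Big),$$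 the limits existing. It is the vacuum state $\Omega(X)=\langle0|X|0\rangle$, where $|0\rangle$ is the normalized constant function, and with $m=\sum_jm_j$, $n=\sum_jn_j$ its values are $$\Omega\Big(\prod_{j=1}^r e^{i\alpha_j\hat p}e^{i(m_j-n_j)\hat\varphi}\Big)=\delta_{m,n}\,\exp\Big(i\sum_{j=1}^r\sum_{k=1}^j\alpha_k(m_j-n_j)\Big).$$ -/

import Mathlib

open scoped Kronecker Matrix

noncomputable section

namespace QuasiSpin

/-! ### Quasi-spins at finite `N` -/

/-- Labels of the computational (product) basis of `(ℂ²)^{⊗N}`; the label `0` is spin up. -/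
abbrev Config (N : ℕ) : Type := Fin N → Fin 2

/-- Operators on `(ℂ²)^{⊗N}`. -/
abbrev Op (N : ℕ) : Type := Matrix (Config N) (Config N) ℂ

/-- Operators on the doubled space `(ℂ²)^{⊗N} ⊗ (ℂ²)^{⊗N}`. -/
abbrev Op2 (N : ℕ) : Type := Matrix (Config N × Config N) (Config N × Config N) ℂ

/-- The Pauli matrix `σ_x`. -/
def pauliX : Matrix (Fin 2) (Fin 2) ℂ := !![0, 1; 1, 0]

/-- The Pauli matrix `σ_y`. -/
def pauliY : Matrix (Fin 2) (Fin 2) ℂ := !![0, -Complex.I; Complex.I, 0]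

/-- The Pauli matrix `σ_z`. -/
def pauliZ : Matrix (Fin 2) (Fin 2) ℂ := !![1, 0; 0, -1]

/-- The one-site matrix `A` acting on the `k`-th tensor factor, and the identity on the others. -/
def site {N : ℕ} (A : Matrix (Fin 2) (Fin 2) ℂ) (k : Fin N) : Op N :=
  Matrix.of fun a b => if ∀ j, j ≠ k → a j = b j then A (a k) (b k) else 0

/-- The collective operator `½ ∑ₖ A⁽ᵏ⁾`. -/
def collective (N : ℕ) (A : Matrix (Fin 2) (Fin 2) ℂ) : Op N :=
  (1 / 2 : ℂ) • ∑ k : Fin N, site A k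

/-- `S_x`. -/
def Sx (N : ℕ) : Op N := collective N pauliX

/-- `S_y`. -/
def Sy (N : ℕ) : Op N := collective N pauliY

/-- `S_z`. -/
def Sz (N : ℕ) : Op N := collective N pauliZ

/-- `S_+ = S_x + i S_y`. -/
def Splus (N : ℕ) : Op N := Sx N + Complex.I • Sy N

/-- `S_- = S_x - i S_y`. -/
def Sminus (N : ℕ) : Op N := Sx N - Complex.I • Sy N

/-- The Casimir operator `S_x² + S_y² + S_z²`. -/
def casimir (N : ℕ) : Op N := Sx N ^ 2 + Sy N ^ 2 + Sz N ^ 2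

/-- The strong-coupling BCS Hamiltonian `H = -2ε S_z - (2 T_c / N) S_+ S_-`. -/
def hamiltonian (ε Tc : ℝ) (N : ℕ) : Op N :=
  ((-2 * ε : ℝ) : ℂ) • Sz N - ((2 * Tc / N : ℝ) : ℂ) • (Splus N * Sminus N)

/-- The Gibbs density matrix `ρ = e^{-βH} / Tr e^{-βH}`. -/
def gibbs (ε Tc β : ℝ) (N : ℕ) : Op N :=
  (NormedSpace.exp ((-β : ℂ) • hamiltonian ε Tc N)).trace⁻¹ •
    NormedSpace.exp ((-β : ℂ) • hamiltonian ε Tc N)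

/-- The Gibbs expectation `Tr (ρ X)`. -/
def gibbsExp (ε Tc β : ℝ) (N : ℕ) (X : Op N) : ℂ := (gibbs ε Tc β N * X).trace

/-- `Δ` is the modulus of a non-vanishing gap at inverse temperature `β`: it is positive and
satisfies the consistency condition `β_c ω = tanh (β ω)`, where `β_c = 1 / T_c` and
`ω = √(ε² + 4 T_c² Δ²)`. -/
def IsGapModulus (ε Tc β Δ : ℝ) : Prop :=
  0 < Δ ∧ (1 / Tc) * √(ε ^ 2 + 4 * Tc ^ 2 * Δ ^ 2) =
    Real.tanh (β * √(ε ^ 2 + 4 * Tc ^ 2 * Δ ^ 2))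

/-- An orthonormal basis of `(ℂ²)^{⊗N}` that consists of joint eigenvectors of the Casimir operator
(with eigenvalue `s (s + 1)`) and of `S_z` (with eigenvalue `m`). -/
def IsSpinBasis {N : ℕ}
    (b : OrthonormalBasis (Fin (2 ^ N)) ℂ (EuclideanSpace ℂ (Config N))) : Prop :=
  ∀ i, ∃ s m : ℝ, 0 ≤ s ∧
    casimir N *ᵥ (b i).ofLp = ((s * (s + 1) : ℝ) : ℂ) • (b i).ofLp ∧
    Sz N *ᵥ (b i).ofLp = (m : ℂ) • (b i).ofLp

/-- The diagonal entry `⟨bᵢ, ρ bᵢ⟩` of the Gibbs density matrix; if `b` is a basis of eigenvectors,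
this is the eigenvalue (Boltzmann weight) belonging to `bᵢ`. -/
def weight (ε Tc β : ℝ) {N : ℕ}
    (b : OrthonormalBasis (Fin (2 ^ N)) ℂ (EuclideanSpace ℂ (Config N))) (i : Fin (2 ^ N)) : ℝ :=
  (star (b i).ofLp ⬝ᵥ (gibbs ε Tc β N *ᵥ (b i).ofLp)).re

/-- The purified Gibbs vector `∑ᵢ √rᵢ bᵢ ⊗ bᵢ` in the doubled space. -/
def purified (ε Tc β : ℝ) {N : ℕ}
    (b : OrthonormalBasis (Fin (2 ^ N)) ℂ (EuclideanSpace ℂ (Config N))) :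
    Config N × Config N → ℂ :=
  fun x => ∑ i, (√(weight ε Tc β b i) : ℂ) * ((b i).ofLp x.1 * (b i).ofLp x.2)

/-- The expectation `⟨Ψ, X Ψ⟩` in the purified Gibbs vector. -/
def purifiedExp (ε Tc β : ℝ) {N : ℕ}
    (b : OrthonormalBasis (Fin (2 ^ N)) ℂ (EuclideanSpace ℂ (Config N))) (X : Op2 N) : ℂ :=
  star (purified ε Tc β b) ⬝ᵥ (X *ᵥ purified ε Tc β b)

/-- `p = S_z ⊗ I - I ⊗ S_z`. -/
def momentum (N : ℕ) : Op2 N := Sz N ⊗ₖ (1 : Op N) - (1 : Op N) ⊗ₖ Sz N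

/-- `E_+ = S_+ ⊗ I / (c N)`. -/
def Eplus (c : ℝ) (N : ℕ) : Op2 N := ((c * N : ℝ) : ℂ)⁻¹ • (Splus N ⊗ₖ (1 : Op N))

/-- `E_- = S_- ⊗ I / (c N)`. -/
def Eminus (c : ℝ) (N : ℕ) : Op2 N := ((c * N : ℝ) : ℂ)⁻¹ • (Sminus N ⊗ₖ (1 : Op N))

/-- The ordered product `∏ⱼ e^{iαⱼ p} (E_-)^{nⱼ} (E_+)^{mⱼ}`, factors written from left to right. -/
def microWord (c : ℝ) (N : ℕ) {r : ℕ} (α : Fin r → ℝ) (m n : Fin r → ℕ) : Op2 N :=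
  (List.ofFn fun j =>
    NormedSpace.exp ((Complex.I * (α j : ℂ)) • momentum N) *
      Eminus c N ^ n j * Eplus c N ^ m j).prod

/-! ### The Heisenberg algebra on the circle -/

instance fact_two_pi_pos : Fact (0 < 2 * Real.pi) := ⟨Real.two_pi_pos⟩

/-- The circle `ℝ / 2πℤ`. -/
abbrev Circle2Pi : Type := AddCircle (2 * Real.pi)

/-- `L²` of the circle with respect to the normalized Haar measure `dθ / 2π`. -/
abbrev L2Circle : Type :=
  MeasureTheory.Lp ℂ 2 (AddCircle.haarAddCircle : MeasureTheory.Measure Circle2Pi)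

/-- The operator `e^{iα p̂}`: `(e^{iα p̂} ψ)(θ) = ψ(θ + α)`. -/
def shiftOp (α : ℝ) : L2Circle →L[ℂ] L2Circle :=
  (MeasureTheory.Lp.compMeasurePreservingₗᵢ ℂ (fun θ : Circle2Pi => θ + (α : Circle2Pi))
    (MeasureTheory.measurePreserving_add_right AddCircle.haarAddCircle
      (α : Circle2Pi))).toContinuousLinearMap

/-- The operator `e^{ik φ̂}`, `k ∈ ℤ`: `(e^{ik φ̂} ψ)(θ) = e^{ikθ} ψ(θ)`. -/
def phaseOp (k : ℤ) : L2Circle →L[ℂ] L2Circle :=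
  (ContinuousLinearMap.mul ℂ ℂ).holderL AddCircle.haarAddCircle ⊤ 2 2 (fourierLp ⊤ k)

/-- The Heisenberg algebra on the circle: the C⋆-algebra generated by all `e^{iα p̂}` (`α ∈ ℝ`)
and all `e^{ik φ̂}` (`k ∈ ℤ`), acting on `L²` of the circle. -/
def heisenberg : StarSubalgebra ℂ (L2Circle →L[ℂ] L2Circle) :=
  (StarAlgebra.adjoin ℂ (Set.range shiftOp ∪ Set.range phaseOp)).topologicalClosure

/-- `e^{iα p̂}` as an element of the Heisenberg algebra. -/
def expP (α : ℝ) : heisenberg :=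
  ⟨shiftOp α, StarSubalgebra.le_topologicalClosure _
    (StarAlgebra.subset_adjoin ℂ _ (Or.inl ⟨α, rfl⟩))⟩

/-- `e^{ik φ̂}` as an element of the Heisenberg algebra. -/
def expPhi (k : ℤ) : heisenberg :=
  ⟨phaseOp k, StarSubalgebra.le_topologicalClosure _
    (StarAlgebra.subset_adjoin ℂ _ (Or.inr ⟨k, rfl⟩))⟩

/-- The ordered product `∏ⱼ e^{iαⱼ p̂} e^{i(mⱼ - nⱼ) φ̂}`, factors written from left to right. -/
def mesoWord {r : ℕ} (α : Fin r → ℝ) (m n : Fin r → ℕ) : heisenberg :=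
  (List.ofFn fun j => expP (α j) * expPhi ((m j : ℤ) - (n j : ℤ))).prod

/-- A state: a bounded linear functional that is positive and normalized. -/
structure IsState (ω : heisenberg →L[ℂ] ℂ) : Prop where
  nonneg_re : ∀ X, 0 ≤ (ω (star X * X)).re
  im_eq_zero : ∀ X, (ω (star X * X)).im = 0
  map_one : ω 1 = 1

/-- The vacuum vector `|0⟩`, the constant function `1` (a unit vector for `dθ / 2π`). -/
def vacuum : L2Circle := fourierLp 2 0

/-- The vacuum functional `X ↦ ⟨0| X |0⟩`. -/
def vacuumState : heisenberg →L[ℂ] ℂ :=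
  (innerSL ℂ vacuum ∘L ContinuousLinearMap.apply ℂ L2Circle vacuum) ∘L
    heisenberg.toSubalgebra.toSubmodule.subtypeL

theorem vacuumState_apply (X : heisenberg) :
    vacuumState X = inner ℂ vacuum ((X : L2Circle →L[ℂ] L2Circle) vacuum) := rfl

end QuasiSpin

end

open scoped Kronecker Matrix

noncomputable section

namespace QuasiSpin

/-! ### Algebra of the collective spin operators -/

/-! Everything is diagonal in a joint eigenbasis of the Casimir operator and `S_z`. There `S_+ S_-`
has the eigenvalue `pairing c m = c - m² + m`, and the Gibbs weight is proportional to `exp (a m +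
(l / N) pairing c m)` with `a = 2βε`, `l = 2βT_c`. The heart of the matter is that the density
`pairing / N²` concentrates at `Δ²` under these weights.

Concentration follows from matching bounds on the partition function, with exponent `N (a²/(4l) +
log (2 cosh y) - y²/l)` where `l = coupling y`. The lower bound `le_partitionFn` is the Peierls
inequality in a basis of rotated product states. For the upper bound `partitionFn_le`, Casimir
eigenvalues are counted by descending the `S_z`-ladder (`sum_casimir_eq`), degeneracies are
estimated exponentially, and concavity of `w ↦ log cosh √w` identifies the maximizer. Only
commutation relations and double counting are used, no decomposition into irreducible
representations. An exponential moment of the pairing is a ratio of partition functions at two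
couplings, so the bounds give tails that are exponentially small on both sides
(`exponential_moment_le`, `eventually_sum_prob_abs_le`). The gap equation says that `y = βω` solves
the mean-field equation, and then the concentration point is `Δ²`.

For the correlations, a word with unequal numbers of raising and lowering operators shifts the
`S_z`-eigenvalue, so its expectation is zero. A balanced word acts as a scalar, equal to a power of
the pairing density up to `O(1/N)` (`NearMonomial`); the factors `1/Δ` normalize its limit to one.
The exponentials of `p` contribute exact phases already at finite `N` (`microWord_mulVec_tensor`),
the same as those of `e^{iα p̂}` on Fourier modes (`mesoWord_vacuum`). Uniqueness holds because the
words span a dense subspace of the algebra. -/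

theorem site_mulVec {N : ℕ} (A : Matrix (Fin 2) (Fin 2) ℂ) (k : Fin N) (v : Config N → ℂ)
    (x : Config N) :
    (site A k *ᵥ v) x = ∑ t, A (x k) t * v (Function.update x k t) := by
  have h := Finset.sum_image (s := (Finset.univ : Finset (Fin 2)))
    (g := fun t => Function.update x k t)
    (f := fun y => site A k x y * v y)
    (fun a _ b _ hab => Function.update_injective x k hab)
  have h2 : ∑ y ∈ Finset.univ.image (fun t => Function.update x k t), site A k x y * v y =
      ∑ y, site A k x y * v y := by
    apply Finset.sum_subset (Finset.subset_univ _)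
    intro y _ hy
    have : ¬ ∀ j, j ≠ k → x j = y j := by
      intro hj
      apply hy
      simp only [Finset.mem_image, Finset.mem_univ, true_and]
      refine ⟨y k, ?_⟩
      funext j
      by_cases hjk : j = k
      · subst hjk; simp
      · simp [hjk, hj j hjk]
    simp only [site, Matrix.of_apply, if_neg this, zero_mul]
  simp only [Matrix.mulVec, dotProduct]
  rw [← h2, h]
  refine Finset.sum_congr rfl fun t _ => ?_
  have : ∀ j, j ≠ k → x j = Function.update x k t j := by
    intro j hj; simp [hj]
  simp only [site, Matrix.of_apply, if_pos this, Function.update_self]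

theorem site_mul_site_same {N : ℕ} (A B : Matrix (Fin 2) (Fin 2) ℂ) (k : Fin N) :
    site A k * site B k = site (A * B) k := by
  apply Matrix.mulVec_injective
  funext v
  funext x
  rw [← Matrix.mulVec_mulVec]
  simp only [site_mulVec, Function.update_self, Function.update_idem, Matrix.mul_apply,
    Fin.sum_univ_two]
  ring

theorem site_comm {N : ℕ} (A B : Matrix (Fin 2) (Fin 2) ℂ) {k l : Fin N} (h : k ≠ l) :
    site A k * site B l = site B l * site A k := by
  apply Matrix.mulVec_injective
  funext v
  funext x
  simp only [← Matrix.mulVec_mulVec]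
  simp only [site_mulVec, Function.update_of_ne h, Function.update_of_ne h.symm, Fin.sum_univ_two,
    Function.update_comm h]
  ring

theorem site_add {N : ℕ} (A B : Matrix (Fin 2) (Fin 2) ℂ) (k : Fin N) :
    site (A + B) k = site A k + site B k := by
  ext x y
  simp only [site, Matrix.of_apply, Matrix.add_apply]
  split_ifs <;> simp

theorem site_smul {N : ℕ} (z : ℂ) (A : Matrix (Fin 2) (Fin 2) ℂ) (k : Fin N) :
    site (z • A) k = z • site A k := by
  ext x y
  simp only [site, Matrix.of_apply, Matrix.smul_apply]
  split_ifs <;> simp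

theorem site_conjTranspose {N : ℕ} (A : Matrix (Fin 2) (Fin 2) ℂ) (k : Fin N) :
    (site A k)ᴴ = site Aᴴ k := by
  ext x y
  simp only [site, Matrix.of_apply, Matrix.conjTranspose_apply]
  have h : (∀ j, j ≠ k → y j = x j) ↔ ∀ j, j ≠ k → x j = y j :=
    forall₂_congr fun j _ => eq_comm
  simp only [h]
  split_ifs <;> simp

theorem collective_add (N : ℕ) (A B : Matrix (Fin 2) (Fin 2) ℂ) :
    collective N (A + B) = collective N A + collective N B := by
  simp only [collective, site_add, Finset.sum_add_distrib, smul_add]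

theorem collective_smul (N : ℕ) (z : ℂ) (A : Matrix (Fin 2) (Fin 2) ℂ) :
    collective N (z • A) = z • collective N A := by
  simp only [collective, site_smul, ← Finset.smul_sum]
  rw [smul_comm]

theorem collective_conjTranspose (N : ℕ) (A : Matrix (Fin 2) (Fin 2) ℂ) :
    (collective N A)ᴴ = collective N Aᴴ := by
  simp [collective, Matrix.conjTranspose_smul, Matrix.conjTranspose_sum, site_conjTranspose]

/-- Operators at different sites commute, so only the diagonal of the double sum survives. One of
the two prefactors `1 / 2` is absorbed by the collective operator on the right. -/
theorem collective_commutator (N : ℕ) (A B : Matrix (Fin 2) (Fin 2) ℂ) :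
    collective N A * collective N B - collective N B * collective N A =
      (1 / 2 : ℂ) • collective N (A * B - B * A) := by
  have key : (∑ k : Fin N, site A k) * (∑ l : Fin N, site B l) -
      (∑ l : Fin N, site B l) * (∑ k : Fin N, site A k) =
      ∑ k : Fin N, site (A * B - B * A) k := by
    rw [Finset.sum_mul_sum, Finset.sum_mul_sum,
      Finset.sum_comm (f := fun i j => site B i * site A j), ← Finset.sum_sub_distrib]
    refine Finset.sum_congr rfl fun k _ => ?_
    rw [← Finset.sum_sub_distrib, Finset.sum_eq_single k]
    · rw [site_mul_site_same, site_mul_site_same, sub_eq_add_neg (A * B), site_add,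
        ← neg_one_smul ℂ (B * A), site_smul, neg_one_smul, sub_eq_add_neg]
    · intro l _ hl
      rw [site_comm A B hl.symm, sub_self]
    · simp
  simp only [collective, smul_mul_smul_comm, ← smul_sub, key, smul_smul]

theorem Sx_conjTranspose (N : ℕ) : (Sx N)ᴴ = Sx N := by
  rw [Sx, collective_conjTranspose]
  congr 1
  ext i j; fin_cases i <;> fin_cases j <;> simp [pauliX]

theorem Sy_conjTranspose (N : ℕ) : (Sy N)ᴴ = Sy N := by
  rw [Sy, collective_conjTranspose]
  congr 1
  ext i j; fin_cases i <;> fin_cases j <;> simp [pauliY]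

theorem Sz_conjTranspose (N : ℕ) : (Sz N)ᴴ = Sz N := by
  rw [Sz, collective_conjTranspose]
  congr 1
  ext i j; fin_cases i <;> fin_cases j <;> simp [pauliZ]

theorem Splus_conjTranspose (N : ℕ) : (Splus N)ᴴ = Sminus N := by
  simp [Splus, Sminus, Matrix.conjTranspose_add, Matrix.conjTranspose_smul, Sx_conjTranspose,
    Sy_conjTranspose, sub_eq_add_neg]

theorem Sminus_conjTranspose (N : ℕ) : (Sminus N)ᴴ = Splus N := by
  rw [← Splus_conjTranspose, Matrix.conjTranspose_conjTranspose]

theorem casimir_conjTranspose (N : ℕ) : (casimir N)ᴴ = casimir N := by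
  simp [casimir, Matrix.conjTranspose_add, Matrix.conjTranspose_pow, Sx_conjTranspose,
    Sy_conjTranspose, Sz_conjTranspose]

theorem Sx_Sy_commutator (N : ℕ) : Sx N * Sy N - Sy N * Sx N = Complex.I • Sz N := by
  rw [Sx, Sy, Sz, collective_commutator, ← collective_smul, ← collective_smul]
  congr 1
  ext i j; fin_cases i <;> fin_cases j <;> simp [pauliX, pauliY, pauliZ] <;> ring

theorem Sy_Sz_commutator (N : ℕ) : Sy N * Sz N - Sz N * Sy N = Complex.I • Sx N := by
  rw [Sx, Sy, Sz, collective_commutator, ← collective_smul, ← collective_smul]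
  congr 1
  ext i j; fin_cases i <;> fin_cases j <;> simp [pauliX, pauliY, pauliZ] <;> ring

theorem Sz_Sx_commutator (N : ℕ) : Sz N * Sx N - Sx N * Sz N = Complex.I • Sy N := by
  rw [Sx, Sy, Sz, collective_commutator, ← collective_smul, ← collective_smul]
  congr 1
  ext i j; fin_cases i <;> fin_cases j <;> simp [pauliX, pauliY, pauliZ] <;> ring

theorem Sz_mul_Splus (N : ℕ) : Sz N * Splus N = Splus N * Sz N + Splus N := by
  have h1 := Sz_Sx_commutator N
  have h2 := Sy_Sz_commutator N
  rw [← sub_eq_zero] at h1 h2 ⊢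
  simp only [Splus, mul_add, add_mul, smul_mul_assoc, mul_smul_comm]
  -- Here `Complex.I` is treated as an indeterminate; the leftover coefficient vanishes because `I²
  -- = -1`.
  calc _ = (Sz N * Sx N - Sx N * Sz N - Complex.I • Sy N) -
      Complex.I • (Sy N * Sz N - Sz N * Sy N - Complex.I • Sx N) +
        (- Complex.I * Complex.I - 1) • Sx N := by module
    _ = 0 := by rw [h1, h2]; simp

theorem Sz_mul_Sminus (N : ℕ) : Sz N * Sminus N = Sminus N * Sz N - Sminus N := by
  have h := congrArg Matrix.conjTranspose (Sz_mul_Splus N)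
  rw [Matrix.conjTranspose_add, Matrix.conjTranspose_mul, Matrix.conjTranspose_mul,
    Sz_conjTranspose, Splus_conjTranspose] at h
  rw [h]; abel

theorem Splus_mul_Sminus (N : ℕ) :
    Splus N * Sminus N = casimir N - Sz N ^ 2 + Sz N := by
  have h1 := Sx_Sy_commutator N
  rw [← sub_eq_zero] at h1 ⊢
  simp only [Splus, Sminus, casimir, mul_sub, add_mul, smul_mul_assoc, mul_smul_comm, sq]
  calc _ = -Complex.I • (Sx N * Sy N - Sy N * Sx N - Complex.I • Sz N) +
        (- Complex.I * Complex.I - 1) • (Sz N + Sy N * Sy N) := by module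
    _ = 0 := by rw [h1]; simp

theorem Sminus_mul_Splus (N : ℕ) :
    Sminus N * Splus N = casimir N - Sz N ^ 2 - Sz N := by
  have h1 := Sx_Sy_commutator N
  rw [← sub_eq_zero] at h1 ⊢
  simp only [Splus, Sminus, casimir, mul_add, sub_mul, smul_mul_assoc, mul_smul_comm, sq]
  calc _ = Complex.I • (Sx N * Sy N - Sy N * Sx N - Complex.I • Sz N) +
        (Complex.I * Complex.I + 1) • (Sz N - Sy N * Sy N) := by module
    _ = 0 := by rw [h1]; simp

/-- The Casimir operator equals both `S_- S_+ + S_z² + S_z` and `S_+ S_- + S_z² - S_z`; pulling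
`S_+` to the left through the second form produces the first. -/
theorem casimir_comm_Splus (N : ℕ) : casimir N * Splus N = Splus N * casimir N := by
  have hm := Sminus_mul_Splus N
  have hp := Splus_mul_Sminus N
  have hz := Sz_mul_Splus N
  have e1 : casimir N = Sminus N * Splus N + Sz N ^ 2 + Sz N := by rw [hm]; abel
  have e2 : casimir N = Splus N * Sminus N + Sz N ^ 2 - Sz N := by rw [hp]; abel
  have hz2 : Sz N * Sz N * Splus N = Splus N * Sz N * Sz N + 2 • (Splus N * Sz N) + Splus N := by
    rw [mul_assoc, hz, mul_add, ← mul_assoc, hz]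
    noncomm_ring
  calc casimir N * Splus N = Splus N * Sminus N * Splus N + Sz N * Sz N * Splus N
        - Sz N * Splus N := by rw [e2]; noncomm_ring
    _ = Splus N * (Sminus N * Splus N + Sz N ^ 2 + Sz N) := by
        rw [hz2, hz]; noncomm_ring
    _ = _ := by rw [← e1]

theorem casimir_comm_Sminus (N : ℕ) : casimir N * Sminus N = Sminus N * casimir N := by
  have h := congrArg Matrix.conjTranspose (casimir_comm_Splus N)
  rw [Matrix.conjTranspose_mul, Matrix.conjTranspose_mul, casimir_conjTranspose,
    Splus_conjTranspose] at h
  exact h.symm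

/-! ### Orthonormal bases and eigenvectors -/

section OrthonormalBases

variable {n ι κ : Type*} [Fintype n] [Fintype ι] [Fintype κ]

theorem star_dotProduct_mulVec (A : Matrix n n ℂ) (v w : n → ℂ) :
    star v ⬝ᵥ (A *ᵥ w) = star (Aᴴ *ᵥ v) ⬝ᵥ w := by
  rw [Matrix.dotProduct_mulVec, Matrix.star_mulVec, Matrix.conjTranspose_conjTranspose]

theorem star_dotProduct_comm (v w : n → ℂ) : star v ⬝ᵥ w = star (star w ⬝ᵥ v) := by
  rw [Matrix.star_dotProduct, dotProduct_comm]

theorem star_dotProduct_self (v : n → ℂ) :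
    star v ⬝ᵥ v = ((∑ i, ‖v i‖ ^ 2 : ℝ) : ℂ) := by
  simp only [dotProduct, Pi.star_apply, RCLike.star_def]
  push_cast
  exact Finset.sum_congr rfl fun i _ => Complex.conj_mul' (v i)

theorem star_dotProduct_self_re_nonneg (v : n → ℂ) : 0 ≤ (star v ⬝ᵥ v).re := by
  rw [star_dotProduct_self, Complex.ofReal_re]
  positivity

theorem inner_eq_star_dotProduct (x y : EuclideanSpace ℂ n) :
    inner ℂ x y = star x.ofLp ⬝ᵥ y.ofLp := by
  rw [EuclideanSpace.inner_eq_star_dotProduct, dotProduct_comm]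

theorem basis_dotProduct [DecidableEq ι] (b : OrthonormalBasis ι ℂ (EuclideanSpace ℂ n)) (i j : ι) :
    star (b i).ofLp ⬝ᵥ (b j).ofLp = if i = j then 1 else 0 := by
  rw [← inner_eq_star_dotProduct, b.inner_eq_ite]

theorem basis_dotProduct_self (b : OrthonormalBasis ι ℂ (EuclideanSpace ℂ n)) (i : ι) :
    star (b i).ofLp ⬝ᵥ (b i).ofLp = 1 := by
  classical
  rw [basis_dotProduct, if_pos rfl]

theorem basis_parseval (b : OrthonormalBasis ι ℂ (EuclideanSpace ℂ n)) (v : n → ℂ) :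
    ∑ i, ‖star (b i).ofLp ⬝ᵥ v‖ ^ 2 = (star v ⬝ᵥ v).re := by
  have h := b.sum_sq_norm_inner_right (WithLp.toLp 2 v)
  simp only [inner_eq_star_dotProduct] at h
  rw [h, ← inner_self_eq_norm_sq (𝕜 := ℂ), inner_eq_star_dotProduct]
  rfl

theorem norm_star_dotProduct_comm (v w : n → ℂ) : ‖star v ⬝ᵥ w‖ = ‖star w ⬝ᵥ v‖ := by
  rw [star_dotProduct_comm, norm_star]

theorem basis_parseval' (b : OrthonormalBasis ι ℂ (EuclideanSpace ℂ n)) (v : n → ℂ) :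
    ∑ i, ‖star v ⬝ᵥ (b i).ofLp‖ ^ 2 = (star v ⬝ᵥ v).re := by
  rw [← basis_parseval b v]
  simp only [norm_star_dotProduct_comm v]

theorem basis_sum_dotProduct (b : OrthonormalBasis ι ℂ (EuclideanSpace ℂ n)) (v w : n → ℂ) :
    ∑ i, (star v ⬝ᵥ (b i).ofLp) * (star (b i).ofLp ⬝ᵥ w) = star v ⬝ᵥ w := by
  have h := b.sum_inner_mul_inner (WithLp.toLp 2 v) (WithLp.toLp 2 w)
  simpa only [inner_eq_star_dotProduct] using h

theorem trace_eq_sum_basis [DecidableEq n] (b : OrthonormalBasis ι ℂ (EuclideanSpace ℂ n))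
    (A : Matrix n n ℂ) : A.trace = ∑ i, star (b i).ofLp ⬝ᵥ (A *ᵥ (b i).ofLp) := by
  have h := (Matrix.toEuclideanLin A).trace_eq_sum_inner b
  simp only [inner_eq_star_dotProduct] at h
  have h2 : LinearMap.trace ℂ _ (Matrix.toEuclideanLin A) = A.trace := by
    change LinearMap.trace ℂ _ (Matrix.toLpLin 2 2 A) = _
    rw [Matrix.toLpLin_eq_toLin, Matrix.trace_toLin_eq]
  rw [← h2, h]
  rfl

/-- Orthogonality of eigenspaces in contrapositive form. Applied to the Casimir operator and to
`S_z` it supplies all the selection rules below. -/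
theorem eigenvalue_eq_of_dotProduct_ne_zero {A : Matrix n n ℂ} (hA : Aᴴ = A) {v w : n → ℂ}
    {μ ν : ℝ} (hv : A *ᵥ v = (μ : ℂ) • v) (hw : A *ᵥ w = (ν : ℂ) • w) (h : star v ⬝ᵥ w ≠ 0) :
    μ = ν := by
  have h1 := star_dotProduct_mulVec A v w
  rw [hA, hv, hw, star_smul, smul_dotProduct, dotProduct_smul] at h1
  simp only [smul_eq_mul, RCLike.star_def, Complex.conj_ofReal] at h1
  exact_mod_cast (mul_right_cancel₀ h h1).symm

theorem dotProduct_mulVec_eq_sum {A : Matrix n n ℂ} (hA : Aᴴ = A)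
    (b : OrthonormalBasis ι ℂ (EuclideanSpace ℂ n)) {a : ι → ℝ}
    (hb : ∀ i, A *ᵥ (b i).ofLp = (a i : ℂ) • (b i).ofLp) (v : n → ℂ) :
    (star v ⬝ᵥ (A *ᵥ v)).re = ∑ i, ‖star (b i).ofLp ⬝ᵥ v‖ ^ 2 * a i := by
  rw [← basis_sum_dotProduct b, Complex.re_sum]
  refine Finset.sum_congr rfl fun i _ => ?_
  rw [star_dotProduct_mulVec A, hA, hb, star_smul, smul_dotProduct, star_dotProduct_comm v]
  simp only [smul_eq_mul, RCLike.star_def, Complex.conj_ofReal]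
  rw [mul_left_comm, ← Complex.normSq_eq_conj_mul_self, Complex.normSq_eq_norm_sq, ← Complex.ofReal_mul,
    Complex.ofReal_re, mul_comm]

/-- The Peierls inequality. -/
theorem sum_exp_expectation_le {A : Matrix n n ℂ} (hA : Aᴴ = A)
    (b : OrthonormalBasis ι ℂ (EuclideanSpace ℂ n)) {a : ι → ℝ}
    (hb : ∀ i, A *ᵥ (b i).ofLp = (a i : ℂ) • (b i).ofLp)
    (φ : OrthonormalBasis κ ℂ (EuclideanSpace ℂ n)) :
    ∑ k, Real.exp (star (φ k).ofLp ⬝ᵥ (A *ᵥ (φ k).ofLp)).re ≤ ∑ i, Real.exp (a i) := by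
  have h1 : ∀ k, Real.exp (star (φ k).ofLp ⬝ᵥ (A *ᵥ (φ k).ofLp)).re ≤
      ∑ i, ‖star (b i).ofLp ⬝ᵥ (φ k).ofLp‖ ^ 2 * Real.exp (a i) := by
    intro k
    rw [dotProduct_mulVec_eq_sum hA b hb]
    -- Jensen's inequality: the squared overlaps of two orthonormal bases are doubly stochastic.
    -- Their sum over `i` is used here, their sum over `k` at the end.
    have := convexOn_exp.map_sum_le (t := Finset.univ)
      (w := fun i => ‖star (b i).ofLp ⬝ᵥ (φ k).ofLp‖ ^ 2) (p := a)
      (fun i _ => by positivity)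
      (by rw [basis_parseval, basis_dotProduct_self]; rfl) (fun i _ => Set.mem_univ _)
    simpa using this
  refine (Finset.sum_le_sum fun k _ => h1 k).trans (le_of_eq ?_)
  rw [Finset.sum_comm]
  refine Finset.sum_congr rfl fun i _ => ?_
  rw [← Finset.sum_mul, basis_parseval', basis_dotProduct_self]
  simp

/-- Squared overlaps are doubly stochastic and vanish between different eigenvalues. This carries
the known spectrum of `S_z` on product states over to an arbitrary joint eigenbasis. -/
theorem sum_eigenvalues_eq {A : Matrix n n ℂ} (hA : Aᴴ = A)
    (b : OrthonormalBasis ι ℂ (EuclideanSpace ℂ n)) {a : ι → ℝ}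
    (hb : ∀ i, A *ᵥ (b i).ofLp = (a i : ℂ) • (b i).ofLp)
    (φ : OrthonormalBasis κ ℂ (EuclideanSpace ℂ n)) {a' : κ → ℝ}
    (hφ : ∀ k, A *ᵥ (φ k).ofLp = (a' k : ℂ) • (φ k).ofLp) (f : ℝ → ℝ) :
    ∑ i, f (a i) = ∑ k, f (a' k) := by
  calc ∑ i, f (a i) = ∑ i, ∑ k, ‖star (b i).ofLp ⬝ᵥ (φ k).ofLp‖ ^ 2 * f (a i) := by
        refine Finset.sum_congr rfl fun i _ => ?_
        rw [← Finset.sum_mul, basis_parseval', basis_dotProduct_self]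
        simp
    _ = ∑ i, ∑ k, ‖star (b i).ofLp ⬝ᵥ (φ k).ofLp‖ ^ 2 * f (a' k) := by
        refine Finset.sum_congr rfl fun i _ => Finset.sum_congr rfl fun k _ => ?_
        by_cases h : star (b i).ofLp ⬝ᵥ (φ k).ofLp = 0
        · simp [h]
        · rw [eigenvalue_eq_of_dotProduct_ne_zero hA (hb i) (hφ k) h]
    _ = _ := by
        rw [Finset.sum_comm]
        refine Finset.sum_congr rfl fun k _ => ?_
        rw [← Finset.sum_mul, basis_parseval, basis_dotProduct_self]
        simp

end OrthonormalBases

/-! ### Product eigenbases -/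

/-- The eigenvalue `½ ∑ⱼ ±1` of the collective spin in a product state. -/
def mag {N : ℕ} (k : Config N) : ℝ := (1 / 2) * ∑ j, (if k j = 0 then (1 : ℝ) else -1)

/-- The sum over configurations factorizes over the sites, each contributing `e^{τ/2} + e^{-τ/2}`.
-/
theorem sum_exp_mag (N : ℕ) (τ : ℝ) :
    ∑ k : Config N, Real.exp (τ * mag k) = (2 * Real.cosh (τ / 2)) ^ N := by
  have h := Finset.prod_univ_sum (fun _ : Fin N => (Finset.univ : Finset (Fin 2)))
    (fun _ s => Real.exp (τ / 2 * (if s = 0 then (1 : ℝ) else -1)))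
  rw [Fintype.piFinset_univ] at h
  have h2 : ∀ k : Config N, Real.exp (τ * mag k) =
      ∏ j, Real.exp (τ / 2 * (if k j = 0 then (1 : ℝ) else -1)) := by
    intro k
    rw [← Real.exp_sum, ← Finset.mul_sum, mag]
    congr 1
    ring
  simp only [h2]
  rw [← h]
  simp [Fin.sum_univ_two, Real.cosh_eq, mul_div_cancel₀]

theorem mag_eq {N : ℕ} (k : Config N) : ∃ l : ℕ, l ≤ N ∧ mag k = -(N : ℝ) / 2 + l := by
  refine ⟨(Finset.univ.filter fun j => k j = 0).card, ?_, ?_⟩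
  · simpa using Finset.card_filter_le (Finset.univ : Finset (Fin N)) (fun j => k j = 0)
  · have : ∀ j, (if k j = 0 then (1 : ℝ) else -1) = 2 * (if k j = 0 then (1 : ℝ) else 0) - 1 := by
      intro j; split_ifs <;> norm_num
    simp only [mag, this]
    rw [Finset.sum_sub_distrib, ← Finset.mul_sum, Finset.sum_boole]
    simp
    ring

/-- The product vector with the factors `u · (k j)`. -/
def productVec {N : ℕ} (u : Matrix (Fin 2) (Fin 2) ℂ) (k : Config N) : Config N → ℂ :=
  fun x => ∏ j, u (x j) (k j)

theorem site_mulVec_productVec {N : ℕ} {A u : Matrix (Fin 2) (Fin 2) ℂ}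
    (hA : A * u = u * Matrix.diagonal ![1, -1]) (k : Config N) (j : Fin N) :
    site A j *ᵥ productVec u k = (if k j = 0 then (1 : ℂ) else -1) • productVec u k := by
  funext x
  have hprod : ∀ t, productVec u k (Function.update x j t) =
      u t (k j) * ∏ i ∈ Finset.univ.erase j, u (x i) (k i) := by
    intro t
    rw [productVec, ← Finset.mul_prod_erase _ _ (Finset.mem_univ j), Function.update_self]
    congr 1
    refine Finset.prod_congr rfl fun i hi => ?_
    rw [Function.update_of_ne (Finset.ne_of_mem_erase hi)]
  have hx : productVec u k x = u (x j) (k j) * ∏ i ∈ Finset.univ.erase j, u (x i) (k i) := by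
    rw [← hprod, Function.update_eq_self]
  rw [site_mulVec, Pi.smul_apply, hx]
  simp only [hprod, ← mul_assoc, ← Finset.sum_mul]
  rw [← Matrix.mul_apply, hA, Matrix.mul_diagonal, smul_eq_mul, ← mul_assoc,
    mul_comm (u (x j) (k j))]
  congr 2
  generalize k j = s
  fin_cases s <;> simp

theorem collective_mulVec_productVec {N : ℕ} {A u : Matrix (Fin 2) (Fin 2) ℂ}
    (hA : A * u = u * Matrix.diagonal ![1, -1]) (k : Config N) :
    collective N A *ᵥ productVec u k = (mag k : ℂ) • productVec u k := by
  rw [collective, Matrix.smul_mulVec, Matrix.sum_mulVec]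
  simp only [site_mulVec_productVec hA]
  rw [← Finset.sum_smul, smul_smul]
  congr 1
  simp only [mag]
  push_cast
  congr 1
  refine Finset.sum_congr rfl fun j _ => ?_
  split_ifs <;> simp

theorem productVec_dotProduct {N : ℕ} {u : Matrix (Fin 2) (Fin 2) ℂ} (hu : uᴴ * u = 1)
    (k l : Config N) : star (productVec u k) ⬝ᵥ productVec u l = if k = l then 1 else 0 := by
  have h := Finset.prod_univ_sum (fun _ : Fin N => (Finset.univ : Finset (Fin 2)))
    (fun j s => star (u s (k j)) * u s (l j))
  rw [Fintype.piFinset_univ] at h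
  have h2 : star (productVec u k) ⬝ᵥ productVec u l =
      ∑ x : Config N, ∏ j, (star (u (x j) (k j)) * u (x j) (l j)) := by
    simp only [dotProduct, Pi.star_apply, productVec, star_prod, Finset.prod_mul_distrib]
  rw [h2, ← h]
  have h3 : ∀ j, ∑ s, star (u s (k j)) * u s (l j) = if k j = l j then 1 else 0 := by
    intro j
    have := congrFun (congrFun hu (k j)) (l j)
    rwa [Matrix.mul_apply, Matrix.one_apply] at this
  simp only [h3]
  split_ifs with hkl
  · simp [hkl]
  · obtain ⟨j, hj⟩ := Function.ne_iff.1 hkl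
    exact Finset.prod_eq_zero (Finset.mem_univ j) (if_neg hj)

theorem exists_product_eigenbasis (N : ℕ) {A u : Matrix (Fin 2) (Fin 2) ℂ} (hu : uᴴ * u = 1)
    (hA : A * u = u * Matrix.diagonal ![1, -1]) :
    ∃ φ : OrthonormalBasis (Config N) ℂ (EuclideanSpace ℂ (Config N)),
      ∀ k, collective N A *ᵥ (φ k).ofLp = (mag k : ℂ) • (φ k).ofLp := by
  have hon : Orthonormal ℂ fun k : Config N => (WithLp.toLp 2 (productVec u k) :
      EuclideanSpace ℂ (Config N)) := by
    rw [orthonormal_iff_ite]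
    intro k l
    rw [inner_eq_star_dotProduct]
    exact productVec_dotProduct hu k l
  have hcard : Fintype.card (Config N) = Module.finrank ℂ (EuclideanSpace ℂ (Config N)) := by
    simp
  refine ⟨(basisOfOrthonormalOfCardEqFinrank hon hcard).toOrthonormalBasis (by simpa using hon),
    fun k => ?_⟩
  simp only [Module.Basis.coe_toOrthonormalBasis, coe_basisOfOrthonormalOfCardEqFinrank]
  exact collective_mulVec_productVec hA k

theorem exists_rotated_eigenbasis (N : ℕ) (θ : ℝ) :
    ∃ φ : OrthonormalBasis (Config N) ℂ (EuclideanSpace ℂ (Config N)),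
      ∀ k, ((Real.cos θ : ℂ) • Sz N + (Real.sin θ : ℂ) • Sx N) *ᵥ (φ k).ofLp =
        (mag k : ℂ) • (φ k).ofLp := by
  have h1 : (Real.cos (θ / 2) : ℂ) ^ 2 + (Real.sin (θ / 2) : ℂ) ^ 2 = 1 := by
    exact_mod_cast Real.cos_sq_add_sin_sq (θ / 2)
  have hc : (Real.cos θ : ℂ) = (Real.cos (θ / 2) : ℂ) ^ 2 - (Real.sin (θ / 2) : ℂ) ^ 2 := by
    have := Real.cos_two_mul' (θ / 2)
    rw [mul_div_cancel₀ _ (two_ne_zero)] at this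
    exact_mod_cast this
  have hs : (Real.sin θ : ℂ) = 2 * (Real.sin (θ / 2) : ℂ) * (Real.cos (θ / 2) : ℂ) := by
    have := Real.sin_two_mul (θ / 2)
    rw [mul_div_cancel₀ _ (two_ne_zero)] at this
    exact_mod_cast this
  have hS : (Real.cos θ : ℂ) • Sz N + (Real.sin θ : ℂ) • Sx N =
      collective N ((Real.cos θ : ℂ) • pauliZ + (Real.sin θ : ℂ) • pauliX) := by
    rw [collective_add, collective_smul, collective_smul, Sz, Sx]
  rw [hS, hc, hs]
  generalize Real.cos (θ / 2) = c at *
  generalize Real.sin (θ / 2) = s at *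
  -- The columns are the spin states along the axis at angle `θ` in the `z`-`x` plane; spin one half
  -- brings in the half angle.
  refine exists_product_eigenbasis N (u := !![(c : ℂ), -(s : ℂ); (s : ℂ), (c : ℂ)]) ?_ ?_
  · ext i j
    fin_cases i <;> fin_cases j <;> simp [Matrix.mul_apply] <;>
      first | linear_combination h1 | ring
  · ext i j
    fin_cases i <;> fin_cases j <;> simp [Matrix.mul_apply, pauliX, pauliZ]
    · linear_combination (c : ℂ) * h1
    · linear_combination (s : ℂ) * h1
    · linear_combination (s : ℂ) * h1
    · linear_combination -(c : ℂ) * h1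

/-! ### Joint eigenvectors of the Casimir operator and of `S_z` -/

/-- `v` is a joint eigenvector: `S² v = c v` and `S_z v = m v`. -/
def IsWeightVec {N : ℕ} (c m : ℝ) (v : Config N → ℂ) : Prop :=
  casimir N *ᵥ v = (c : ℂ) • v ∧ Sz N *ᵥ v = (m : ℂ) • v

namespace IsWeightVec

variable {N : ℕ} {c m : ℝ} {v : Config N → ℂ}

theorem splus (h : IsWeightVec c m v) : IsWeightVec c (m + 1) (Splus N *ᵥ v) := by
  constructor
  · rw [Matrix.mulVec_mulVec, casimir_comm_Splus, ← Matrix.mulVec_mulVec, h.1, Matrix.mulVec_smul]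
  · rw [Matrix.mulVec_mulVec, Sz_mul_Splus, Matrix.add_mulVec, ← Matrix.mulVec_mulVec, h.2,
      Matrix.mulVec_smul]
    push_cast
    rw [add_smul, one_smul]

theorem sminus (h : IsWeightVec c m v) : IsWeightVec c (m - 1) (Sminus N *ᵥ v) := by
  constructor
  · rw [Matrix.mulVec_mulVec, casimir_comm_Sminus, ← Matrix.mulVec_mulVec, h.1, Matrix.mulVec_smul]
  · rw [Matrix.mulVec_mulVec, Sz_mul_Sminus, Matrix.sub_mulVec, ← Matrix.mulVec_mulVec, h.2,
      Matrix.mulVec_smul]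
    push_cast
    rw [sub_smul, one_smul]

theorem splus_sminus (h : IsWeightVec c m v) :
    Splus N *ᵥ (Sminus N *ᵥ v) = ((c - m ^ 2 + m : ℝ) : ℂ) • v := by
  rw [Matrix.mulVec_mulVec, Splus_mul_Sminus, Matrix.add_mulVec, Matrix.sub_mulVec, sq,
    ← Matrix.mulVec_mulVec, h.2, Matrix.mulVec_smul, h.2, h.1]
  push_cast
  module

theorem sminus_splus (h : IsWeightVec c m v) :
    Sminus N *ᵥ (Splus N *ᵥ v) = ((c - m ^ 2 - m : ℝ) : ℂ) • v := by
  rw [Matrix.mulVec_mulVec, Sminus_mul_Splus, Matrix.sub_mulVec, Matrix.sub_mulVec, sq,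
    ← Matrix.mulVec_mulVec, h.2, Matrix.mulVec_smul, h.2, h.1]
  push_cast
  module

theorem splus_dotProduct_self (h : IsWeightVec c m v) :
    star (Splus N *ᵥ v) ⬝ᵥ (Splus N *ᵥ v) = ((c - m ^ 2 - m : ℝ) : ℂ) * (star v ⬝ᵥ v) := by
  rw [← Sminus_conjTranspose, ← star_dotProduct_mulVec, Sminus_conjTranspose, h.sminus_splus,
    dotProduct_smul, smul_eq_mul]

theorem sminus_dotProduct_self (h : IsWeightVec c m v) :
    star (Sminus N *ᵥ v) ⬝ᵥ (Sminus N *ᵥ v) = ((c - m ^ 2 + m : ℝ) : ℂ) * (star v ⬝ᵥ v) := by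
  rw [← Splus_conjTranspose, ← star_dotProduct_mulVec, Splus_conjTranspose, h.splus_sminus,
    dotProduct_smul, smul_eq_mul]

end IsWeightVec

/-- `b` is an orthonormal basis of joint eigenvectors, with Casimir eigenvalues `c i` and
`S_z`-eigenvalues `m i`. -/
def IsWeightBasis {N : ℕ} {ι : Type*} [Fintype ι]
    (b : OrthonormalBasis ι ℂ (EuclideanSpace ℂ (Config N))) (c m : ι → ℝ) : Prop :=
  ∀ i, IsWeightVec (c i) (m i) (b i).ofLp

namespace IsWeightBasis

variable {N : ℕ} {ι : Type*} [Fintype ι]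
  {b : OrthonormalBasis ι ℂ (EuclideanSpace ℂ (Config N))} {c m : ι → ℝ}

/-- The quantity is the squared norm of `S_- bᵢ`. -/
theorem casimir_add_nonneg (h : IsWeightBasis b c m) (i : ι) : 0 ≤ c i - m i ^ 2 + m i := by
  have h1 := (h i).sminus_dotProduct_self
  have h2 := star_dotProduct_self_re_nonneg (Sminus N *ᵥ (b i).ofLp)
  rwa [h1, basis_dotProduct_self, mul_one, Complex.ofReal_re] at h2

/-- By Parseval `bᵢ` overlaps with some product state, and overlapping eigenvectors of `S_z` share
their eigenvalue. -/
theorem exists_m_eq (h : IsWeightBasis b c m) (i : ι) :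
    ∃ l : ℕ, l ≤ N ∧ m i = -(N : ℝ) / 2 + l := by
  obtain ⟨φ, hφ⟩ := exists_rotated_eigenbasis N 0
  simp only [Real.cos_zero, Real.sin_zero, Complex.ofReal_one, Complex.ofReal_zero, one_smul,
    zero_smul, add_zero] at hφ
  have hp := basis_parseval φ (b i).ofLp
  rw [basis_dotProduct_self] at hp
  obtain ⟨k, -, hk⟩ := Finset.exists_ne_zero_of_sum_ne_zero
    (hp.trans_ne (by simp : (1 : ℂ).re ≠ 0))
  have hk' : star (φ k).ofLp ⬝ᵥ (b i).ofLp ≠ 0 := by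
    intro h0; simp [h0] at hk
  obtain ⟨l, hl, hml⟩ := mag_eq k
  exact ⟨l, hl, by
    rw [← hml, eigenvalue_eq_of_dotProduct_ne_zero (Sz_conjTranspose N) (hφ k) (h i).2 hk']⟩

theorem abs_m_le (h : IsWeightBasis b c m) (i : ι) : |m i| ≤ N / 2 := by
  obtain ⟨l, hl, hm⟩ := h.exists_m_eq i
  have : (l : ℝ) ≤ N := by exact_mod_cast hl
  rw [hm, abs_le]
  constructor <;> linarith [(Nat.cast_nonneg l : (0 : ℝ) ≤ l)]

theorem sum_exp_m (h : IsWeightBasis b c m) (τ : ℝ) :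
    ∑ i, Real.exp (τ * m i) = (2 * Real.cosh (τ / 2)) ^ N := by
  obtain ⟨φ, hφ⟩ := exists_rotated_eigenbasis N 0
  simp only [Real.cos_zero, Real.sin_zero, Complex.ofReal_one, Complex.ofReal_zero, one_smul,
    zero_smul, add_zero] at hφ
  rw [← sum_exp_mag, sum_eigenvalues_eq (Sz_conjTranspose N) b (fun i => (h i).2) φ hφ
    (fun x => Real.exp (τ * x))]

/-- The number of basis vectors of `S_z`-eigenvalue `x`. -/
def degeneracy (m : ι → ℝ) (x : ℝ) : ℝ := ∑ i, if m i = x then 1 else 0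

theorem degeneracy_nonneg (m : ι → ℝ) (x : ℝ) : 0 ≤ degeneracy m x :=
  Finset.sum_nonneg fun i _ => by split_ifs <;> norm_num

/-- An exponential Chebyshev bound, with the tilt `τ` left free so that it can be adapted to `x`. -/
theorem degeneracy_mul_exp_le (h : IsWeightBasis b c m) (τ x : ℝ) :
    degeneracy m x * Real.exp (τ * x) ≤ (2 * Real.cosh (τ / 2)) ^ N := by
  rw [← h.sum_exp_m τ, degeneracy, Finset.sum_mul]
  refine Finset.sum_le_sum fun i _ => ?_
  split_ifs with hi
  · rw [hi, one_mul]
  · rw [zero_mul]; positivity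

/-- Double counting of the transition weights `u i j = |⟨bᵢ, S_+ bⱼ⟩|²`. They preserve the Casimir
eigenvalue and raise `m` by one; their column sums are `‖S_+ bⱼ‖²`, their row sums `‖S_- bᵢ‖²`, and
both equal `c - x² - x` on the relevant levels. -/
theorem sum_shift (h : IsWeightBasis b c m) (g : ℝ → ℝ) (x : ℝ) :
    (∑ i, if m i = x then g (c i) * (c i - x ^ 2 - x) else 0) =
      ∑ i, if m i = x + 1 then g (c i) * (c i - x ^ 2 - x) else 0 := by
  set u : ι → ι → ℝ := fun i j => ‖star (b i).ofLp ⬝ᵥ (Splus N *ᵥ (b j).ofLp)‖ ^ 2 with hu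
  have h1 : ∀ j, ∑ i, u i j = c j - m j ^ 2 - m j := by
    intro j
    simp only [hu]
    rw [basis_parseval, (h j).splus_dotProduct_self, basis_dotProduct_self, mul_one,
      Complex.ofReal_re]
  have h2 : ∀ i, ∑ j, u i j = c i - m i ^ 2 + m i := by
    intro i
    simp only [hu, star_dotProduct_mulVec, Splus_conjTranspose]
    rw [basis_parseval', (h i).sminus_dotProduct_self, basis_dotProduct_self, mul_one,
      Complex.ofReal_re]
  have h3 : ∀ i j, u i j ≠ 0 → c i = c j ∧ m i = m j + 1 := by
    intro i j hij
    have hij' : star (b i).ofLp ⬝ᵥ (Splus N *ᵥ (b j).ofLp) ≠ 0 := by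
      intro h0; simp [hu, h0] at hij
    exact ⟨eigenvalue_eq_of_dotProduct_ne_zero (casimir_conjTranspose N) (h i).1 (h j).splus.1 hij',
      eigenvalue_eq_of_dotProduct_ne_zero (Sz_conjTranspose N) (h i).2 (h j).splus.2 hij'⟩
  calc (∑ i, if m i = x then g (c i) * (c i - x ^ 2 - x) else 0)
      = ∑ j, ∑ i, (if m j = x then g (c j) else 0) * u i j := by
        refine Finset.sum_congr rfl fun j _ => ?_
        rw [← Finset.mul_sum, h1]
        split_ifs with hj
        · rw [hj]
        · simp
    _ = ∑ j, ∑ i, (if m i = x + 1 then g (c i) else 0) * u i j := by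
        refine Finset.sum_congr rfl fun j _ => Finset.sum_congr rfl fun i _ => ?_
        by_cases hij : u i j = 0
        · simp [hij]
        · obtain ⟨hc, hm⟩ := h3 i j hij
          rw [hc, hm]
          simp only [add_left_inj]
    _ = _ := by
        rw [Finset.sum_comm]
        refine Finset.sum_congr rfl fun i _ => ?_
        rw [← Finset.mul_sum, h2]
        split_ifs with hi
        · rw [hi]; ring
        · simp

/-- Descent along the ladder of `S_z`-eigenvalues. -/
theorem sum_casimir_eq (h : IsWeightBasis b c m) (f : ℝ → ℝ) (x : ℝ) :
    (∑ i, if m i = x then f (c i) else 0) = (∑ i, if m i = x + 1 then f (c i) else 0) +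
      f (x ^ 2 + x) * (degeneracy m x - degeneracy m (x + 1)) := by
  -- With the divided difference of `f` the weight `c - x² - x` cancels. Where the denominator
  -- vanishes so does the numerator, hence the value `0` of the quotient is harmless.
  have h1 := h.sum_shift (fun y => (f y - f (x ^ 2 + x)) / (y - x ^ 2 - x)) x
  have h2 : ∀ y, (f y - f (x ^ 2 + x)) / (y - x ^ 2 - x) * (y - x ^ 2 - x) =
      f y - f (x ^ 2 + x) := by
    intro y
    by_cases hy : y - x ^ 2 - x = 0
    · have : y = x ^ 2 + x := by linarith
      rw [hy, this]; simp
    · exact div_mul_cancel₀ _ hy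
  simp only [h2] at h1
  have h3 : ∀ x', (∑ i, if m i = x' then f (c i) - f (x ^ 2 + x) else 0) =
      (∑ i, if m i = x' then f (c i) else 0) - f (x ^ 2 + x) * degeneracy m x' := by
    intro x'
    rw [degeneracy, Finset.mul_sum, ← Finset.sum_sub_distrib]
    refine Finset.sum_congr rfl fun i _ => ?_
    split_ifs <;> simp
  rw [h3, h3] at h1
  linarith

/-- The descent is iterated from above the top level, where nothing is left. Replacing differences
of degeneracies by sums and bounding every level by the full sum costs only factors polynomial in
`N`. -/
theorem sum_casimir_le (h : IsWeightBasis b c m) {f : ℝ → ℝ} (hf : ∀ y, 0 ≤ f y) :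
    ∑ i, f (c i) ≤ (N + 1) * ∑ l ∈ Finset.range (N + 1),
      f ((-(N : ℝ) / 2 + l) ^ 2 + (-(N : ℝ) / 2 + l)) *
        (degeneracy m (-(N : ℝ) / 2 + l) + degeneracy m (-(N : ℝ) / 2 + l + 1)) := by
  set F : ℕ → ℝ := fun l => ∑ i, if m i = -(N : ℝ) / 2 + l then f (c i) else 0 with hF
  set G : ℕ → ℝ := fun l => f ((-(N : ℝ) / 2 + l) ^ 2 + (-(N : ℝ) / 2 + l)) *
        (degeneracy m (-(N : ℝ) / 2 + l) + degeneracy m (-(N : ℝ) / 2 + l + 1)) with hG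
  have hG0 : ∀ l, 0 ≤ G l := fun l =>
    mul_nonneg (hf _) (add_nonneg (degeneracy_nonneg _ _) (degeneracy_nonneg _ _))
  have hstep : ∀ l, F l ≤ F (l + 1) + G l := by
    intro l
    have := h.sum_casimir_eq f (-(N : ℝ) / 2 + l)
    simp only [hF, hG]
    push_cast
    rw [← add_assoc, this]
    gcongr
    · exact hf _
    · linarith [degeneracy_nonneg m (-(N : ℝ) / 2 + l + 1)]
  have hend : F (N + 1) = 0 := by
    refine Finset.sum_eq_zero fun i _ => if_neg ?_
    have := (abs_le.1 (h.abs_m_le i)).2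
    push_cast
    intro hi
    linarith
  -- Induction on the distance `k` from the empty level `N + 1`.
  have hbound : ∀ k, k ≤ N + 1 → F (N + 1 - k) ≤ ∑ l ∈ Finset.Ico (N + 1 - k) (N + 1), G l := by
    intro k
    induction k with
    | zero => intro _; simp [hend]
    | succ k ih =>
      intro hk
      have e : N + 1 - (k + 1) + 1 = N + 1 - k := by omega
      have h1 := hstep (N + 1 - (k + 1))
      rw [e] at h1
      rw [Finset.sum_eq_sum_Ico_succ_bot (by omega), e]
      linarith [ih (by omega)]
  have hbound' : ∀ l ∈ Finset.range (N + 1), F l ≤ ∑ l ∈ Finset.range (N + 1), G l := by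
    intro l hl
    have hl' := Finset.mem_range.1 hl
    have h1 := hbound (N + 1 - l) (by omega)
    rw [show N + 1 - (N + 1 - l) = l by omega] at h1
    refine h1.trans (Finset.sum_le_sum_of_subset_of_nonneg ?_ fun _ _ _ => hG0 _)
    intro a ha
    exact Finset.mem_range.2 (Finset.mem_Ico.1 ha).2
  have htot : ∑ i, f (c i) = ∑ l ∈ Finset.range (N + 1), F l := by
    simp only [hF]
    rw [Finset.sum_comm]
    refine Finset.sum_congr rfl fun i _ => ?_
    obtain ⟨l, hl, hm⟩ := h.exists_m_eq i
    rw [Finset.sum_eq_single l]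
    · rw [if_pos hm]
    · intro l' _ hne
      refine if_neg fun h' => hne ?_
      rw [hm] at h'
      exact_mod_cast (add_left_cancel h').symm
    · intro hl'
      exact absurd (Finset.mem_range.2 (by omega)) hl'
  rw [htot]
  refine (Finset.sum_le_sum hbound').trans ?_
  rw [Finset.sum_const, Finset.card_range, nsmul_eq_mul]
  push_cast
  exact le_rfl

/-- With the indicator of the value `c i` as test function, the left side of `sum_casimir_le` is
positive, so `c i = x² + x` for some admissible level `|x| ≤ N / 2`. -/
theorem casimir_le (h : IsWeightBasis b c m) (i : ι) : c i ≤ (N / 2 : ℝ) ^ 2 + N / 2 := by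
  have h1 := h.sum_casimir_le (f := fun y => if y = c i then 1 else 0)
    (fun y => by split_ifs <;> norm_num)
  have h2 : (1 : ℝ) ≤ ∑ j, if c j = c i then 1 else 0 := by
    have := Finset.single_le_sum (f := fun j => if c j = c i then (1 : ℝ) else 0)
      (fun j _ => by positivity) (Finset.mem_univ i)
    simpa using this
  by_contra hcon
  push Not at hcon
  have h3 := h2.trans h1
  rw [Finset.sum_eq_zero, mul_zero] at h3
  · linarith
  · intro l hl
    have hl' : (l : ℝ) ≤ N := by exact_mod_cast Nat.lt_succ_iff.1 (Finset.mem_range.1 hl)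
    rw [if_neg, zero_mul]
    intro heq
    nlinarith [(Nat.cast_nonneg l : (0 : ℝ) ≤ l), heq, hcon]

end IsWeightBasis

/-! ### The function `log cosh` -/

theorem strictConvexOn_sinh : StrictConvexOn ℝ (Set.Ici 0) Real.sinh := by
  apply strictConvexOn_of_deriv2_pos (convex_Ici 0) Real.continuous_sinh.continuousOn
  intro x hx
  rw [interior_Ici] at hx
  simpa using hx

theorem mul_sinh_lt {d s : ℝ} (hd : 0 < d) (hs : d < s) : s * Real.sinh d < d * Real.sinh s := by
  have h := strictConvexOn_sinh.secant_strict_mono (a := 0) (x := d) (y := s)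
    (Set.mem_Ici.2 le_rfl) hd.le (hd.trans hs).le hd.ne' (hd.trans hs).ne' hs
  simp only [Real.sinh_zero, sub_zero] at h
  rw [div_lt_div_iff₀ hd (hd.trans hs)] at h
  linarith

/-- After clearing denominators and applying the addition formulas, this is strict monotonicity of
`sinh s / s` between `y - x` and `x + y`. -/
theorem tanh_div_self_lt {x y : ℝ} (hx : 0 < x) (hxy : x < y) :
    Real.tanh y / y < Real.tanh x / x := by
  have hy := hx.trans hxy
  have h := mul_sinh_lt (sub_pos.2 hxy) (by linarith : y - x < x + y)
  rw [Real.sinh_sub, Real.sinh_add] at h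
  rw [Real.tanh_eq_sinh_div_cosh, Real.tanh_eq_sinh_div_cosh, div_div, div_div,
    div_lt_div_iff₀ (mul_pos (Real.cosh_pos y) hy) (mul_pos (Real.cosh_pos x) hx)]
  nlinarith

theorem tanh_pos {y : ℝ} (hy : 0 < y) : 0 < Real.tanh y := by
  rw [Real.tanh_eq_sinh_div_cosh]
  exact div_pos (Real.sinh_pos_iff.2 hy) (Real.cosh_pos y)

/-- `log cosh √w` is a concave function of `w`. -/
theorem log_cosh_le {y₁ : ℝ} (hy₁ : 0 < y₁) (y : ℝ) :
    Real.log (Real.cosh y) ≤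
      Real.log (Real.cosh y₁) + Real.tanh y₁ / (2 * y₁) * (y ^ 2 - y₁ ^ 2) := by
  wlog hy : 0 ≤ y generalizing y
  · have := this (-y) (by linarith)
    rwa [Real.cosh_neg, neg_sq] at this
  -- With this slope the derivative `tanh x - 2kx` of `f` vanishes at `y₁`; as `tanh x / x`
  -- decreases, it is nonnegative before and nonpositive after, so `f` is maximal at `y₁`.
  set k := Real.tanh y₁ / (2 * y₁) with hk
  set f : ℝ → ℝ := fun x => Real.log (Real.cosh x) - k * x ^ 2 with hf
  have hd : ∀ x, HasDerivAt f (Real.tanh x - 2 * k * x) x := by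
    intro x
    have h1 := ((Real.hasDerivAt_cosh x).log (Real.cosh_pos x).ne').sub
      ((hasDerivAt_pow 2 x).const_mul k)
    refine h1.congr_deriv ?_
    rw [Real.tanh_eq_sinh_div_cosh]
    simp
    ring
  have hcont : Continuous f := continuous_iff_continuousAt.2 fun x => (hd x).continuousAt
  have h2k : 2 * k = Real.tanh y₁ / y₁ := by rw [hk]; field_simp
  have main : f y ≤ f y₁ := by
    rcases le_total y y₁ with h | h
    · refine monotoneOn_of_deriv_nonneg (convex_Icc 0 y₁) hcont.continuousOn
        (fun x _ => (hd x).differentiableAt.differentiableWithinAt) ?_ ⟨hy, h⟩ ⟨hy₁.le, le_rfl⟩ h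
      intro x hx
      rw [interior_Icc] at hx
      rw [(hd x).deriv, h2k]
      have := tanh_div_self_lt hx.1 hx.2
      rw [lt_div_iff₀ hx.1] at this
      linarith
    · refine antitoneOn_of_deriv_nonpos (convex_Ici y₁) hcont.continuousOn
        (fun x _ => (hd x).differentiableAt.differentiableWithinAt) ?_ (Set.mem_Ici.2 le_rfl)
        (Set.mem_Ici.2 h) h
      intro x hx
      rw [interior_Ici] at hx
      rw [(hd x).deriv, h2k]
      have := tanh_div_self_lt hy₁ hx
      rw [div_lt_iff₀ (hy₁.trans hx)] at this
      linarith
  simp only [hf] at main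
  linarith

/-- The coupling at which the mean-field equation `tanh y / y = 2 / λ` has the solution `y`. -/
def coupling (y : ℝ) : ℝ := 2 * y / Real.tanh y

theorem coupling_pos {y : ℝ} (hy : 0 < y) : 0 < coupling y :=
  div_pos (by linarith) (tanh_pos hy)

theorem coupling_lt {x y : ℝ} (hx : 0 < x) (hxy : x < y) : coupling x < coupling y := by
  have hy := hx.trans hxy
  have h := tanh_div_self_lt hx hxy
  rw [div_lt_div_iff₀ hy hx] at h
  rw [coupling, coupling, div_lt_div_iff₀ (tanh_pos hx) (tanh_pos hy)]
  linarith

theorem continuousAt_coupling {y : ℝ} (hy : 0 < y) : ContinuousAt coupling y := by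
  have : Continuous Real.tanh := by
    have : Real.tanh = fun x => Real.sinh x / Real.cosh x := funext Real.tanh_eq_sinh_div_cosh
    rw [this]
    exact Real.continuous_sinh.div Real.continuous_cosh fun x => (Real.cosh_pos x).ne'
  exact (continuousAt_const.mul continuousAt_id).div this.continuousAt (tanh_pos hy).ne'

/-- At the coupling belonging to `y₁`, the mean-field functional `y ↦ log (2 cosh y) - y² / l`
attains its maximum at `y₁`. This makes the upper bound on the partition function agree with the
variational lower bound. -/
theorem log_two_cosh_le {y₁ : ℝ} (hy₁ : 0 < y₁) (y : ℝ) :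
    Real.log (2 * Real.cosh y) - y ^ 2 / coupling y₁ ≤
      Real.log (2 * Real.cosh y₁) - y₁ ^ 2 / coupling y₁ := by
  have h := log_cosh_le hy₁ y
  have ht := (tanh_pos hy₁).ne'
  have hk : Real.tanh y₁ / (2 * y₁) * (y ^ 2 - y₁ ^ 2) =
      y ^ 2 / coupling y₁ - y₁ ^ 2 / coupling y₁ := by
    rw [coupling]; field_simp
  rw [hk] at h
  rw [Real.log_mul two_ne_zero (Real.cosh_pos y).ne', Real.log_mul two_ne_zero (Real.cosh_pos y₁).ne']
  linarith

/-! ### The partition function -/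

theorem pow_eq_exp_log {x : ℝ} (hx : 0 < x) (n : ℕ) : x ^ n = Real.exp (n * Real.log x) := by
  rw [← Real.log_pow, Real.exp_log (pow_pos hx n)]

/-- The eigenvalue of `S_+ S_-` on a joint eigenvector. -/
def pairing (c m : ℝ) : ℝ := c - m ^ 2 + m

/-- The unnormalized Boltzmann weight, the eigenvalue of `exp (a S_z + (l / N) S_+ S_-)`. -/
def boltzmann (N : ℕ) (a l c m : ℝ) : ℝ := Real.exp (a * m + l / N * pairing c m)

theorem boltzmann_pos (N : ℕ) (a l c m : ℝ) : 0 < boltzmann N a l c m := Real.exp_pos _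

/-- The partition function `Tr exp (a S_z + (l / N) S_+ S_-)`, as a sum over eigenvalues. -/
def partitionFn {ι : Type*} [Fintype ι] (N : ℕ) (a l : ℝ) (c m : ι → ℝ) : ℝ :=
  ∑ i, boltzmann N a l (c i) (m i)

namespace IsWeightBasis

variable {N : ℕ} {ι : Type*} [Fintype ι]
  {b : OrthonormalBasis ι ℂ (EuclideanSpace ℂ (Config N))} {c m : ι → ℝ}

theorem nonempty (_ : IsWeightBasis b c m) : Nonempty ι := by
  by_contra hcon
  rw [not_nonempty_iff] at hcon
  have h := basis_parseval b (fun _ => (1 : ℂ))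
  simp only [Finset.univ_eq_empty, Finset.sum_empty, dotProduct, Pi.star_apply, star_one, mul_one,
    Finset.sum_const, Finset.card_univ, nsmul_eq_mul, Complex.natCast_re] at h
  exact absurd h.symm (by exact_mod_cast Fintype.card_ne_zero)

theorem partitionFn_pos (h : IsWeightBasis b c m) (a l : ℝ) : 0 < partitionFn N a l c m :=
  have := h.nonempty
  Finset.sum_pos (fun _ _ => boltzmann_pos _ _ _ _ _) Finset.univ_nonempty

/-- The tilt is `τ = 2 l x / N` with `l = coupling y`. In terms of `z = l x / N` the exponent
becomes `N (log (2 cosh z) - z² / l)`, which is maximal at `z = y`. -/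
theorem degeneracy_le (h : IsWeightBasis b c m) (hN : 0 < N) {y : ℝ} (hy : 0 < y) (x : ℝ) :
    degeneracy m x * Real.exp (coupling y / N * x ^ 2) ≤
      Real.exp (N * (Real.log (2 * Real.cosh y) - y ^ 2 / coupling y)) := by
  have hN' : (0 : ℝ) < N := by exact_mod_cast hN
  have hl := coupling_pos hy
  have h1 := h.degeneracy_mul_exp_le (2 * coupling y * x / N) x
  have hτ : 2 * coupling y * x / N / 2 = coupling y * x / N := by ring
  have h2cosh : 0 < 2 * Real.cosh (coupling y * x / N) := by
    have := Real.cosh_pos (coupling y * x / N)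
    positivity
  rw [hτ] at h1
  calc degeneracy m x * Real.exp (coupling y / N * x ^ 2)
      = degeneracy m x * Real.exp (2 * coupling y * x / N * x) *
          Real.exp (-(coupling y / N * x ^ 2)) := by
        rw [mul_assoc, ← Real.exp_add]; congr 2; ring
    _ ≤ (2 * Real.cosh (coupling y * x / N)) ^ N * Real.exp (-(coupling y / N * x ^ 2)) := by
        gcongr
    _ = Real.exp (N * (Real.log (2 * Real.cosh (coupling y * x / N)) -
          (coupling y * x / N) ^ 2 / coupling y)) := by
        rw [pow_eq_exp_log h2cosh, ← Real.exp_add]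
        congr 1
        field_simp
        ring
    _ ≤ _ := by
        apply Real.exp_le_exp.2
        gcongr ?_ * ?_
        exact log_two_cosh_le hy _

theorem sum_exp_casimir_le (h : IsWeightBasis b c m) (hN : 0 < N) {y : ℝ} (hy : 0 < y) :
    ∑ i, Real.exp (coupling y / N * c i) ≤ 2 * (N + 1) ^ 2 * Real.exp (coupling y / 2) *
      Real.exp (N * (Real.log (2 * Real.cosh y) - y ^ 2 / coupling y)) := by
  have hN' : (0 : ℝ) < N := by exact_mod_cast hN
  have hl := coupling_pos hy
  refine (h.sum_casimir_le (f := fun t => Real.exp (coupling y / N * t))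
    (fun t => (Real.exp_pos _).le)).trans ?_
  set E := Real.exp (N * (Real.log (2 * Real.cosh y) - y ^ 2 / coupling y)) with hE
  have hterm : ∀ l ∈ Finset.range (N + 1),
      Real.exp (coupling y / N * ((-(N : ℝ) / 2 + l) ^ 2 + (-(N : ℝ) / 2 + l))) *
        (degeneracy m (-(N : ℝ) / 2 + l) + degeneracy m (-(N : ℝ) / 2 + l + 1)) ≤
      2 * Real.exp (coupling y / 2) * E := by
    intro l hlN
    have hl' : (l : ℝ) ≤ N := by exact_mod_cast Nat.lt_succ_iff.1 (Finset.mem_range.1 hlN)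
    have hl0 : (0 : ℝ) ≤ l := Nat.cast_nonneg l
    set x := -(N : ℝ) / 2 + l with hx
    have hx1 : x ≤ N / 2 := by rw [hx]; linarith
    have hx2 : -(N : ℝ) / 2 ≤ x := by rw [hx]; linarith
    have e1 : Real.exp (coupling y / N * (x ^ 2 + x)) ≤
        Real.exp (coupling y / N * x ^ 2) * Real.exp (coupling y / 2) := by
      rw [← Real.exp_add]
      apply Real.exp_le_exp.2
      have : coupling y / N * x ≤ coupling y / N * (N / 2) := by gcongr
      have e : coupling y / N * (N / 2) = coupling y / 2 := by field_simp
      linarith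
    -- Here `x² + x = (x + 1)² - (x + 1)`, and `-(x + 1) ≤ N / 2`.
    have e2 : Real.exp (coupling y / N * (x ^ 2 + x)) ≤
        Real.exp (coupling y / N * (x + 1) ^ 2) * Real.exp (coupling y / 2) := by
      rw [← Real.exp_add]
      apply Real.exp_le_exp.2
      have : coupling y / N * (-(x + 1)) ≤ coupling y / N * (N / 2) := by gcongr; linarith
      have e : coupling y / N * (N / 2) = coupling y / 2 := by field_simp
      linarith
    have d1 := h.degeneracy_le hN hy x
    have d2 := h.degeneracy_le hN hy (x + 1)
    calc _ = degeneracy m x * Real.exp (coupling y / N * (x ^ 2 + x)) +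
          degeneracy m (x + 1) * Real.exp (coupling y / N * (x ^ 2 + x)) := by ring
      _ ≤ degeneracy m x * (Real.exp (coupling y / N * x ^ 2) * Real.exp (coupling y / 2)) +
          degeneracy m (x + 1) *
            (Real.exp (coupling y / N * (x + 1) ^ 2) * Real.exp (coupling y / 2)) := by
          gcongr
          · exact degeneracy_nonneg m x
          · exact degeneracy_nonneg m (x + 1)
      _ = (degeneracy m x * Real.exp (coupling y / N * x ^ 2) +
          degeneracy m (x + 1) * Real.exp (coupling y / N * (x + 1) ^ 2)) *
            Real.exp (coupling y / 2) := by ring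
      _ ≤ (E + E) * Real.exp (coupling y / 2) := by gcongr
      _ = _ := by ring
  have hsum := Finset.sum_le_sum hterm
  rw [Finset.sum_const, Finset.card_range, nsmul_eq_mul] at hsum
  push_cast at hsum
  calc _ ≤ ((N : ℝ) + 1) * (((N : ℝ) + 1) * (2 * Real.exp (coupling y / 2) * E)) := by gcongr
    _ = _ := by ring

theorem partitionFn_le (h : IsWeightBasis b c m) (hN : 0 < N) (a : ℝ) {y : ℝ} (hy : 0 < y) :
    partitionFn N a (coupling y) c m ≤ 2 * (N + 1) ^ 2 * Real.exp (coupling y) *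
      Real.exp (N * (a ^ 2 / (4 * coupling y) + Real.log (2 * Real.cosh y) -
        y ^ 2 / coupling y)) := by
  have hN' : (0 : ℝ) < N := by exact_mod_cast hN
  have hl := coupling_pos hy
  have hterm : ∀ i, boltzmann N a (coupling y) (c i) (m i) ≤
      Real.exp (N * (a ^ 2 / (4 * coupling y))) * Real.exp (coupling y / 2) *
        Real.exp (coupling y / N * c i) := by
    intro i
    rw [boltzmann, pairing, ← Real.exp_add, ← Real.exp_add]
    apply Real.exp_le_exp.2
    have h1 : coupling y / N * m i ≤ coupling y / N * (N / 2) := by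
      gcongr
      exact (abs_le.1 (h.abs_m_le i)).2
    have e : coupling y / N * (N / 2) = coupling y / 2 := by field_simp
    -- Completing the square in `m i` decouples the field `a` from the Casimir part.
    have h2 : a * m i - coupling y / N * m i ^ 2 ≤ N * (a ^ 2 / (4 * coupling y)) := by
      have : 0 ≤ coupling y / N * (m i - N * a / (2 * coupling y)) ^ 2 := by positivity
      have e2 : coupling y / N * (m i - N * a / (2 * coupling y)) ^ 2 =
          coupling y / N * m i ^ 2 - a * m i + N * (a ^ 2 / (4 * coupling y)) := by
        field_simp; ring
      linarith
    linarith
  refine (Finset.sum_le_sum fun i _ => hterm i).trans ?_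
  rw [← Finset.mul_sum]
  calc _ ≤ Real.exp (N * (a ^ 2 / (4 * coupling y))) * Real.exp (coupling y / 2) *
        (2 * (N + 1) ^ 2 * Real.exp (coupling y / 2) *
          Real.exp (N * (Real.log (2 * Real.cosh y) - y ^ 2 / coupling y))) := by
        gcongr
        exact h.sum_exp_casimir_le hN hy
    _ = 2 * (N + 1) ^ 2 * (Real.exp (coupling y / 2) * Real.exp (coupling y / 2)) *
        (Real.exp (N * (a ^ 2 / (4 * coupling y))) *
          Real.exp (N * (Real.log (2 * Real.cosh y) - y ^ 2 / coupling y))) := by ring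
    _ = _ := by
        rw [← Real.exp_add, ← Real.exp_add]
        congr 2
        · ring_nf
        · ring_nf

/-- The Peierls inequality in a rotated product basis. The exponent is linearized around a
condensate amplitude `ζ` for `S_-`, and the quadratic remainder `(l / N) Tᴴ T` is nonnegative. The
bound holds for every trial `y ≥ |a| / 2`, not only for the solution of the mean-field equation at
`l`. -/
theorem le_partitionFn (h : IsWeightBasis b c m) (hN : 0 < N) {a l y : ℝ} (hl : 0 < l)
    (hy : 0 < y) (ha : |a| ≤ 2 * y) :
    Real.exp (N * (a ^ 2 / (4 * l) + Real.log (2 * Real.cosh y) - y ^ 2 / l)) ≤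
      partitionFn N a l c m := by
  have hN' : (0 : ℝ) < N := by exact_mod_cast hN
  set A : Op N := (a : ℂ) • Sz N + ((l / N : ℝ) : ℂ) • (Splus N * Sminus N) with hA
  have hAh : Aᴴ = A := by
    simp [hA, Matrix.conjTranspose_add, Matrix.conjTranspose_smul, Sz_conjTranspose,
      Matrix.conjTranspose_mul, Splus_conjTranspose, Sminus_conjTranspose]
  have hAb : ∀ i, A *ᵥ (b i).ofLp = ((a * m i + l / N * pairing (c i) (m i) : ℝ) : ℂ) •
      (b i).ofLp := by
    intro i
    rw [hA, Matrix.add_mulVec, Matrix.smul_mulVec, Matrix.smul_mulVec, ← Matrix.mulVec_mulVec,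
      (h i).splus_sminus, (h i).2, smul_smul, smul_smul, ← add_smul, pairing]
    push_cast
    rfl
  -- The direction of the effective field of strength `2y` whose `z`-component is `a`.
  set θ := Real.arccos (a / (2 * y)) with hθ
  have hcos : Real.cos θ = a / (2 * y) := by
    have h1 := abs_le.1 ha
    apply Real.cos_arccos
    · rw [le_div_iff₀ (by positivity)]; linarith
    · rw [div_le_iff₀ (by positivity)]; linarith
  obtain ⟨φ, hφ⟩ := exists_rotated_eigenbasis N θ
  -- This `ζ` makes the cross term `2 (l / N) ζ S_x` equal to the transverse field `2y sin θ S_x`;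
  -- then `κ = (l / N) ζ²`.
  set ζ : ℝ := N * y * Real.sin θ / l with hζ
  set κ : ℝ := N * (y ^ 2 / l - a ^ 2 / (4 * l)) with hκ
  set T : Op N := Sminus N - (ζ : ℂ) • 1 with hT
  have hTT : Tᴴ = Splus N - (ζ : ℂ) • 1 := by
    simp [hT, Matrix.conjTranspose_sub, Matrix.conjTranspose_smul, Sminus_conjTranspose]
  have hdecomp : A = ((2 * y : ℝ) : ℂ) • ((Real.cos θ : ℂ) • Sz N + (Real.sin θ : ℂ) • Sx N) -
      (κ : ℂ) • 1 + ((l / N : ℝ) : ℂ) • (Tᴴ * T) := by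
    have e1 : (a : ℂ) = ((2 * y * Real.cos θ : ℝ) : ℂ) := by
      rw [hcos]; congr 1; field_simp
    have e2 : (κ : ℂ) = ((l / N * ζ ^ 2 : ℝ) : ℂ) := by
      congr 1
      have hs := Real.sin_sq_add_cos_sq θ
      have : Real.sin θ ^ 2 = 1 - (a / (2 * y)) ^ 2 := by rw [← hcos]; linarith
      rw [hζ, hκ]
      have e3 : l / N * (N * y * Real.sin θ / l) ^ 2 = N * y ^ 2 * Real.sin θ ^ 2 / l := by
        field_simp
      rw [e3, this]
      field_simp
      ring
    have e4 : ((l / N * ζ : ℝ) : ℂ) = ((y * Real.sin θ : ℝ) : ℂ) := by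
      congr 1; rw [hζ]; field_simp
    push_cast at e1 e2 e4
    rw [hA, hTT, hT, e1, e2]
    have e5 : (Splus N - (ζ : ℂ) • 1) * (Sminus N - (ζ : ℂ) • 1) =
        Splus N * Sminus N - (2 * ζ : ℂ) • Sx N + ((ζ : ℂ) ^ 2) • 1 := by
      simp only [sub_mul, mul_sub, smul_mul_assoc, mul_smul_comm, one_mul, mul_one]
      simp only [Splus, Sminus]
      module
    rw [e5]
    push_cast
    calc _ = (2 * (y : ℂ) * (Real.cos θ : ℂ)) • Sz N + ((l : ℂ) / N) • (Splus N * Sminus N) +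
        (2 * (y * Real.sin θ : ℂ) - 2 * (l / N * ζ : ℂ)) • Sx N := by rw [e4]; simp
      _ = _ := by module
  have hexp : ∀ k, 2 * y * mag k - κ ≤ (star (φ k).ofLp ⬝ᵥ (A *ᵥ (φ k).ofLp)).re := by
    intro k
    rw [hdecomp, Matrix.add_mulVec, Matrix.sub_mulVec, Matrix.smul_mulVec, hφ, Matrix.smul_mulVec,
      Matrix.smul_mulVec, Matrix.one_mulVec, dotProduct_add, dotProduct_sub, dotProduct_smul,
      dotProduct_smul, dotProduct_smul, dotProduct_smul, basis_dotProduct_self,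
      ← Matrix.mulVec_mulVec, star_dotProduct_mulVec, Matrix.conjTranspose_conjTranspose]
    have h0 := star_dotProduct_self_re_nonneg (T *ᵥ (φ k).ofLp)
    have h1 : 0 ≤ l / N * (star (T *ᵥ (φ k).ofLp) ⬝ᵥ (T *ᵥ (φ k).ofLp)).re := by positivity
    simp only [smul_eq_mul, mul_one, Complex.add_re, Complex.sub_re, Complex.re_ofReal_mul,
      Complex.ofReal_re]
    linarith
  have h2cosh : 0 < 2 * Real.cosh y := by
    have := Real.cosh_pos y
    positivity
  refine le_trans ?_ (sum_exp_expectation_le hAh b hAb φ)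
  calc _ = Real.exp (-κ) * (2 * Real.cosh (2 * y / 2)) ^ N := by
        rw [mul_div_cancel_left₀ _ two_ne_zero, pow_eq_exp_log h2cosh, ← Real.exp_add, hκ]
        congr 1
        ring
    _ = ∑ k : Config N, Real.exp (2 * y * mag k - κ) := by
        rw [← sum_exp_mag, Finset.mul_sum]
        refine Finset.sum_congr rfl fun k _ => ?_
        rw [← Real.exp_add]; congr 1; ring
    _ ≤ _ := Finset.sum_le_sum fun k _ => Real.exp_le_exp.2 (hexp k)

end IsWeightBasis

/-! ### Concentration of the pairing -/

/-- The normalized Boltzmann weight. -/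
def prob {ι : Type*} [Fintype ι] (N : ℕ) (a l : ℝ) (c m : ι → ℝ) (i : ι) : ℝ :=
  boltzmann N a l (c i) (m i) / partitionFn N a l c m

namespace IsWeightBasis

variable {N : ℕ} {ι : Type*} [Fintype ι]
  {b : OrthonormalBasis ι ℂ (EuclideanSpace ℂ (Config N))} {c m : ι → ℝ}

theorem prob_nonneg (h : IsWeightBasis b c m) (a l : ℝ) (i : ι) : 0 ≤ prob N a l c m i :=
  div_nonneg (boltzmann_pos _ _ _ _ _).le (h.partitionFn_pos a l).le

theorem sum_prob (h : IsWeightBasis b c m) (a l : ℝ) : ∑ i, prob N a l c m i = 1 := by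
  simp only [prob]
  rw [← Finset.sum_div]
  exact div_self (h.partitionFn_pos a l).ne'

/-- Up to the constant shift by `D`, the moment is the ratio of the partition functions at `coupling
y` and at `l`. Using the same `y` as trial value in the lower bound cancels the `log cosh` terms.
The sign of `coupling y - l` is arbitrary, so both tails are covered. -/
theorem exponential_moment_le (h : IsWeightBasis b c m) (hN : 0 < N) {a l y : ℝ} (hl : 0 < l)
    (hy : 0 < y) (ha : |a| ≤ 2 * y) (D : ℝ) :
    ∑ i, prob N a l c m i *
        Real.exp (N * (coupling y - l) * (pairing (c i) (m i) / N ^ 2 - D)) ≤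
      2 * (N + 1) ^ 2 * Real.exp (coupling y) *
        Real.exp (N * (coupling y - l) * ((y ^ 2 - a ^ 2 / 4) / (l * coupling y) - D)) := by
  have hN' : (0 : ℝ) < N := by exact_mod_cast hN
  have hc := coupling_pos hy
  have h1 : ∀ i, prob N a l c m i *
      Real.exp (N * (coupling y - l) * (pairing (c i) (m i) / N ^ 2 - D)) =
      boltzmann N a (coupling y) (c i) (m i) *
        (Real.exp (-(N * (coupling y - l) * D)) / partitionFn N a l c m) := by
    intro i
    rw [prob, boltzmann, boltzmann, div_mul_eq_mul_div, ← mul_div_assoc, ← Real.exp_add,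
      ← Real.exp_add]
    congr 2
    field_simp
    ring
  simp only [h1]
  rw [← Finset.sum_mul, ← mul_div_assoc, div_le_iff₀ (h.partitionFn_pos a l)]
  have hup := h.partitionFn_le hN a hy
  have hlow := h.le_partitionFn hN hl hy ha
  have hK : 0 ≤ 2 * ((N : ℝ) + 1) ^ 2 * Real.exp (coupling y) := by positivity
  calc partitionFn N a (coupling y) c m * Real.exp (-(N * (coupling y - l) * D))
      ≤ 2 * (N + 1) ^ 2 * Real.exp (coupling y) *
      Real.exp (N * (a ^ 2 / (4 * coupling y) + Real.log (2 * Real.cosh y) -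
        y ^ 2 / coupling y)) * Real.exp (-(N * (coupling y - l) * D)) := by gcongr
    _ = 2 * (N + 1) ^ 2 * Real.exp (coupling y) *
        Real.exp (N * (coupling y - l) * ((y ^ 2 - a ^ 2 / 4) / (l * coupling y) - D)) *
        Real.exp (N * (a ^ 2 / (4 * l) + Real.log (2 * Real.cosh y) - y ^ 2 / l)) := by
        rw [mul_assoc, mul_assoc _ (Real.exp _) (Real.exp _), ← Real.exp_add, ← Real.exp_add]
        congr 2
        field_simp
        ring
    _ ≤ _ := by gcongr

end IsWeightBasis

/-- Turns exponential moments directly into bounds on a mean deviation, without splitting into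
events. -/
theorem le_add_exp {t x y : ℝ} (ht : 0 < t) : x ≤ y + Real.exp (t * (x - y)) / t := by
  have h := Real.add_one_le_exp (t * (x - y))
  have : t * (x - y) / t ≤ Real.exp (t * (x - y)) / t := by gcongr; linarith
  rw [mul_div_cancel_left₀ _ ht.ne'] at this
  linarith

theorem tendsto_poly_mul_exp {t η : ℝ} (ht : 0 < t) (hη : 0 < η) (K : ℝ) :
    Filter.Tendsto (fun N : ℕ => 2 * ((N : ℝ) + 1) ^ 2 * K * Real.exp (-(N * t * η)) / (N * t))
      Filter.atTop (nhds 0) := by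
  have hr : |Real.exp (-(t * η))| < 1 := by
    rw [abs_of_pos (Real.exp_pos _), Real.exp_lt_one_iff]
    exact neg_neg_of_pos (mul_pos ht hη)
  have h1 := tendsto_pow_const_mul_const_pow_of_abs_lt_one 1 hr
  have h0 := tendsto_pow_const_mul_const_pow_of_abs_lt_one 0 hr
  have hinv := tendsto_inv_atTop_nhds_zero_nat (𝕜 := ℝ)
  have h := (((h1.add (h0.const_mul 2)).add (hinv.mul h0)).const_mul (2 * K / t))
  simp only [mul_zero, add_zero] at h
  refine h.congr' ?_
  filter_upwards [Filter.eventually_gt_atTop 0] with N hN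
  have hN' : (0 : ℝ) < N := by exact_mod_cast hN
  rw [show -(N * t * η) = N * (-(t * η)) by ring, Real.exp_nat_mul]
  field_simp
  ring

/-- The pairing density concentrates at its mean-field value. -/
theorem eventually_sum_prob_abs_le {a y : ℝ} (hy : 0 < y) (ha : |a| < 2 * y) {η : ℝ}
    (hη : 0 < η) :
    ∀ᶠ N : ℕ in Filter.atTop, ∀ {ι : Type} [Fintype ι]
      (b : OrthonormalBasis ι ℂ (EuclideanSpace ℂ (Config N))) (c m : ι → ℝ),
      IsWeightBasis b c m →
      ∑ i, prob N a (coupling y) c m i *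
        |pairing (c i) (m i) / N ^ 2 - (y ^ 2 - a ^ 2 / 4) / coupling y ^ 2| ≤ η := by
  set l := coupling y with hl
  have hlpos : 0 < l := coupling_pos hy
  set D := (y ^ 2 - a ^ 2 / 4) / l ^ 2 with hD
  set Q : ℝ → ℝ := fun x => (x ^ 2 - a ^ 2 / 4) / (l * coupling x) with hQ
  have hQD : Q y = D := by simp only [hQ, hD, ← hl, sq]
  have hQc : ContinuousAt Q y := by
    refine ContinuousAt.div (by fun_prop) (continuousAt_const.mul (continuousAt_coupling hy)) ?_
    exact (mul_pos hlpos hlpos).ne'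
  -- The thresholds will cost `4δ` and each of the two exponential terms `δ`.
  set δ := η / 8 with hδ
  have hδpos : 0 < δ := by positivity
  have hev : ∀ᶠ x in nhds y, |Q x - D| < δ ∧ |a| < 2 * x ∧ 0 < x := by
    have e1 : ∀ᶠ x in nhds y, |Q x - D| < δ := by
      have := Metric.continuousAt_iff'.1 hQc δ hδpos
      rw [hQD] at this
      exact this
    have e2 : ∀ᶠ x in nhds y, |a| < 2 * x :=
      (continuous_const.mul continuous_id).continuousAt.eventually (lt_mem_nhds ha)
    exact e1.and (e2.and (lt_mem_nhds hy))
  -- Trial values slightly above and below `y` give couplings on both sides of `l`, while their `Q`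
  -- stays within `δ` of `D`.
  obtain ⟨y₁, hy₁, hQ₁, ha₁, hpos₁⟩ : ∃ x, y < x ∧ |Q x - D| < δ ∧ |a| < 2 * x ∧ 0 < x := by
    have := (hev.filter_mono (nhdsWithin_le_nhds (s := Set.Ioi y))).and self_mem_nhdsWithin
    obtain ⟨x, hx, hx'⟩ := this.exists
    exact ⟨x, hx', hx⟩
  obtain ⟨y₂, hy₂, hQ₂, ha₂, hpos₂⟩ : ∃ x, x < y ∧ |Q x - D| < δ ∧ |a| < 2 * x ∧ 0 < x := by
    have := (hev.filter_mono (nhdsWithin_le_nhds (s := Set.Iio y))).and self_mem_nhdsWithin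
    obtain ⟨x, hx, hx'⟩ := this.exists
    exact ⟨x, hx', hx⟩
  set t := coupling y₁ - l with ht
  set s := l - coupling y₂ with hs
  have htpos : 0 < t := sub_pos.2 (coupling_lt hy hy₁)
  have hspos : 0 < s := sub_pos.2 (coupling_lt hpos₂ hy₂)
  have lim₁ := tendsto_poly_mul_exp htpos hδpos (Real.exp (coupling y₁))
  have lim₂ := tendsto_poly_mul_exp hspos hδpos (Real.exp (coupling y₂))
  filter_upwards [lim₁.eventually (gt_mem_nhds hδpos), lim₂.eventually (gt_mem_nhds hδpos),
    Filter.eventually_gt_atTop 0] with N hN₁ hN₂ hN ι _ b c m h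
  have hN' : (0 : ℝ) < N := by exact_mod_cast hN
  have m₁ := h.exponential_moment_le hN hlpos hpos₁ ha₁.le D
  have m₂ := h.exponential_moment_le hN hlpos hpos₂ ha₂.le D
  set Y : ι → ℝ := fun i => pairing (c i) (m i) / N ^ 2 - D with hY
  -- The threshold `2δ` exceeds the growth rate `δ` of the moments, which leaves a decay `exp (-N t
  -- δ)`, respectively `exp (-N s δ)`, against a polynomial prefactor.
  have key : ∀ i, |Y i| ≤ 4 * δ + (Real.exp (N * t * (Y i - 2 * δ)) / (N * t) +
      Real.exp (N * s * (-Y i - 2 * δ)) / (N * s)) := by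
    intro i
    have k1 := le_add_exp (x := Y i) (y := 2 * δ) (mul_pos hN' htpos)
    have k2 := le_add_exp (x := -Y i) (y := 2 * δ) (mul_pos hN' hspos)
    have p1 : 0 ≤ Real.exp (N * t * (Y i - 2 * δ)) / (N * t) := by positivity
    have p2 : 0 ≤ Real.exp (N * s * (-Y i - 2 * δ)) / (N * s) := by positivity
    rw [abs_le]
    constructor <;> linarith
  have b₁ : ∑ i, prob N a l c m i * (Real.exp (N * t * (Y i - 2 * δ)) / (N * t)) ≤ δ := by
    calc _ = (∑ i, prob N a l c m i * Real.exp (N * t * Y i)) *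
          (Real.exp (-(2 * (N * t * δ))) / (N * t)) := by
          rw [Finset.sum_mul]
          refine Finset.sum_congr rfl fun i _ => ?_
          have e : Real.exp (N * t * (Y i - 2 * δ)) =
              Real.exp (N * t * Y i) * Real.exp (-(2 * (N * t * δ))) := by
            rw [← Real.exp_add]; congr 1; ring
          rw [e]; ring
      _ ≤ (2 * (N + 1) ^ 2 * Real.exp (coupling y₁) * Real.exp (N * t * δ)) *
          (Real.exp (-(2 * (N * t * δ))) / (N * t)) := by
          gcongr
          refine m₁.trans ?_
          gcongr
          exact (abs_lt.1 hQ₁).2.le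
      _ = 2 * ((N : ℝ) + 1) ^ 2 * Real.exp (coupling y₁) * Real.exp (-(N * t * δ)) / (N * t) := by
          rw [mul_assoc, ← mul_div_assoc (Real.exp _), ← Real.exp_add, ← mul_div_assoc]
          congr 3; ring
      _ ≤ δ := hN₁.le
  have b₂ : ∑ i, prob N a l c m i * (Real.exp (N * s * (-Y i - 2 * δ)) / (N * s)) ≤ δ := by
    calc _ = (∑ i, prob N a l c m i * Real.exp (N * (coupling y₂ - l) * Y i)) *
          (Real.exp (-(2 * (N * s * δ))) / (N * s)) := by
          rw [Finset.sum_mul]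
          refine Finset.sum_congr rfl fun i _ => ?_
          have e : Real.exp (N * s * (-Y i - 2 * δ)) =
              Real.exp (N * (coupling y₂ - l) * Y i) * Real.exp (-(2 * (N * s * δ))) := by
            rw [← Real.exp_add, hs]; congr 1; ring
          rw [e]; ring
      _ ≤ (2 * (N + 1) ^ 2 * Real.exp (coupling y₂) * Real.exp (N * s * δ)) *
          (Real.exp (-(2 * (N * s * δ))) / (N * s)) := by
          gcongr
          refine m₂.trans ?_
          have e : N * (coupling y₂ - l) * (Q y₂ - D) ≤ N * s * δ := by
            have : N * (coupling y₂ - l) * (Q y₂ - D) = N * s * (-(Q y₂ - D)) := by rw [hs]; ring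
            rw [this]
            gcongr
            linarith [(abs_lt.1 hQ₂).1]
          gcongr
      _ = 2 * ((N : ℝ) + 1) ^ 2 * Real.exp (coupling y₂) * Real.exp (-(N * s * δ)) / (N * s) := by
          rw [mul_assoc, ← mul_div_assoc (Real.exp _), ← Real.exp_add, ← mul_div_assoc]
          congr 3; ring
      _ ≤ δ := hN₂.le
  calc _ ≤ ∑ i, prob N a l c m i * (4 * δ + (Real.exp (N * t * (Y i - 2 * δ)) / (N * t) +
      Real.exp (N * s * (-Y i - 2 * δ)) / (N * s))) :=
        Finset.sum_le_sum fun i _ => mul_le_mul_of_nonneg_left (key i) (h.prob_nonneg a l i)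
    _ = 4 * δ + (∑ i, prob N a l c m i * (Real.exp (N * t * (Y i - 2 * δ)) / (N * t)) +
        ∑ i, prob N a l c m i * (Real.exp (N * s * (-Y i - 2 * δ)) / (N * s))) := by
        simp only [mul_add, Finset.sum_add_distrib]
        rw [← Finset.sum_mul, h.sum_prob, one_mul]
    _ ≤ η := by rw [hδ] at b₁ b₂ ⊢; linarith

/-! ### Operators on the circle in the Fourier basis -/

theorem shiftOp_fourierLp (α : ℝ) (k : ℤ) :
    shiftOp α (fourierLp 2 k) = Complex.exp (Complex.I * (α * k)) • fourierLp 2 k := by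
  have hmp := MeasureTheory.measurePreserving_add_right
    (AddCircle.haarAddCircle : MeasureTheory.Measure Circle2Pi) (α : Circle2Pi)
  apply MeasureTheory.Lp.ext
  have h1 := MeasureTheory.Lp.coeFn_compMeasurePreserving (fourierLp (T := 2 * Real.pi) 2 k) hmp
  have h2 := hmp.quasiMeasurePreserving.ae (coeFn_fourierLp (T := 2 * Real.pi) 2 k)
  have h3 := coeFn_fourierLp (T := 2 * Real.pi) 2 k
  have h4 := MeasureTheory.Lp.coeFn_smul (Complex.exp (Complex.I * (α * k)))
    (fourierLp (T := 2 * Real.pi) 2 k)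
  filter_upwards [h1, h2, h3, h4] with x h1 h2 h3 h4
  refine h1.trans ?_
  rw [h4, Pi.smul_apply, h3, Function.comp_apply, h2]
  have : fourier k ((α : ℝ) : Circle2Pi) = Complex.exp (Complex.I * (α * k)) := by
    rw [fourier_coe_apply]
    congr 1
    have : (Real.pi : ℂ) ≠ 0 := by exact_mod_cast Real.pi_ne_zero
    push_cast
    field_simp
  rw [smul_eq_mul, ← this, fourier_apply, fourier_apply, fourier_apply, smul_add,
    AddCircle.toCircle_add, mul_comm]
  rfl

theorem phaseOp_fourierLp (k l : ℤ) :
    phaseOp k (fourierLp 2 l) = fourierLp 2 (k + l) := by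
  apply MeasureTheory.Lp.ext
  have h1 := (ContinuousLinearMap.mul ℂ ℂ).coeFn_holder (μ := AddCircle.haarAddCircle) (r := 2)
    (fourierLp (T := 2 * Real.pi) ⊤ k) (fourierLp (T := 2 * Real.pi) 2 l)
  filter_upwards [h1, coeFn_fourierLp (T := 2 * Real.pi) 2 l, coeFn_fourierLp (T := 2 * Real.pi) ⊤ k,
    coeFn_fourierLp (T := 2 * Real.pi) 2 (k + l)] with x h1 h2 h3 h4
  refine h1.trans ?_
  rw [h2, h3, h4, fourier_add]
  rfl

theorem inner_fourierLp (k l : ℤ) :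
    inner ℂ (fourierLp (T := 2 * Real.pi) 2 k) (fourierLp 2 l) = if k = l then 1 else 0 :=
  orthonormal_iff_ite.1 orthonormal_fourier k l

theorem ext_fourierLp {A B : L2Circle →L[ℂ] L2Circle}
    (h : ∀ k l, inner ℂ (fourierLp 2 k) (A (fourierLp 2 l)) =
      inner ℂ (fourierLp 2 k) (B (fourierLp 2 l))) : A = B := by
  apply ContinuousLinearMap.ext_on (s := Set.range (fourierLp (T := 2 * Real.pi) 2))
  · exact Submodule.dense_iff_topologicalClosure_eq_top.2 (span_fourierLp_closure_eq_top (by simp))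
  · rintro _ ⟨l, rfl⟩
    apply fourierBasis.repr.injective
    ext k
    rw [fourierBasis.repr_apply_apply, fourierBasis.repr_apply_apply, coe_fourierBasis]
    exact h k l

theorem star_shiftOp (α : ℝ) : star (shiftOp α) = shiftOp (-α) := by
  apply ext_fourierLp
  intro k l
  rw [ContinuousLinearMap.star_eq_adjoint, ContinuousLinearMap.adjoint_inner_right,
    shiftOp_fourierLp, shiftOp_fourierLp, inner_smul_left, inner_smul_right, inner_fourierLp]
  split_ifs with hkl
  · rw [hkl, ← Complex.exp_conj]
    simp
  · simp

theorem star_phaseOp (k : ℤ) : star (phaseOp k) = phaseOp (-k) := by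
  apply ext_fourierLp
  intro i j
  rw [ContinuousLinearMap.star_eq_adjoint, ContinuousLinearMap.adjoint_inner_right,
    phaseOp_fourierLp, phaseOp_fourierLp, inner_fourierLp, inner_fourierLp]
  congr 1
  simp only [eq_iff_iff]
  omega

theorem shiftOp_zero : shiftOp 0 = 1 := by
  apply ext_fourierLp
  intro k l
  rw [shiftOp_fourierLp]
  simp

theorem phaseOp_zero : phaseOp 0 = 1 := by
  apply ext_fourierLp
  intro k l
  rw [phaseOp_fourierLp]
  simp

/-! ### Words and their phases -/

/-- The phase `∑ⱼ ∑_{k ≤ j} αₖ (mⱼ - nⱼ)` of a word. -/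
def wordPhase {r : ℕ} (α : Fin r → ℝ) (m n : Fin r → ℕ) : ℂ :=
  ∑ j, ∑ k ∈ Finset.Iic j, (α k : ℂ) * ((m j : ℂ) - (n j : ℂ))

/-- The leftmost angle occurs in every inner sum and so multiplies the total charge; this matches
peeling off the leftmost letter of a word. -/
theorem wordPhase_succ {r : ℕ} (α : Fin (r + 1) → ℝ) (m n : Fin (r + 1) → ℕ) :
    wordPhase α m n = α 0 * ∑ j, ((m j : ℂ) - (n j : ℂ)) +
      wordPhase (fun j => α j.succ) (fun j => m j.succ) (fun j => n j.succ) := by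
  have h : ∀ {s : ℕ} (j : Fin s) (f : Fin s → ℂ),
      ∑ k ∈ Finset.Iic j, f k = ∑ k, if k ≤ j then f k else 0 := by
    intro s j f
    rw [← Finset.sum_filter]
    congr 1
    ext k; simp
  simp only [wordPhase, h]
  rw [Fin.sum_univ_succ, Fin.sum_univ_succ (fun j => (m j : ℂ) - n j)]
  simp only [Fin.sum_univ_succ (n := r), Fin.succ_le_succ_iff, Fin.zero_le, if_true,
    Finset.sum_add_distrib, ← Finset.mul_sum]
  simp only [Fin.le_zero_iff, Fin.succ_ne_zero, if_false, Finset.sum_const_zero, add_zero]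
  ring

theorem mesoWord_succ {r : ℕ} (α : Fin (r + 1) → ℝ) (m n : Fin (r + 1) → ℕ) :
    mesoWord α m n = expP (α 0) * expPhi ((m 0 : ℤ) - (n 0 : ℤ)) *
      mesoWord (fun j => α j.succ) (fun j => m j.succ) (fun j => n j.succ) := by
  simp only [mesoWord, List.ofFn_succ, List.prod_cons]

/-- Each `e^{iα p̂}` reads off the Fourier mode created by the phase factors to its right and its
own letter's. -/
theorem mesoWord_vacuum {r : ℕ} (α : Fin r → ℝ) (m n : Fin r → ℕ) :
    (mesoWord α m n : L2Circle →L[ℂ] L2Circle) vacuum =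
      Complex.exp (Complex.I * wordPhase α m n) •
        fourierLp 2 (∑ j, ((m j : ℤ) - (n j : ℤ))) := by
  induction r with
  | zero => simp [mesoWord, wordPhase, vacuum]
  | succ r ih =>
    have e : ((mesoWord α m n : heisenberg) : L2Circle →L[ℂ] L2Circle) vacuum =
        shiftOp (α 0) (phaseOp ((m 0 : ℤ) - (n 0 : ℤ))
          ((mesoWord (fun j => α j.succ) (fun j => m j.succ) (fun j => n j.succ) :
            L2Circle →L[ℂ] L2Circle) vacuum)) := by
      rw [mesoWord_succ]; rfl
    rw [e, ih, map_smul, map_smul, phaseOp_fourierLp, ← Fin.sum_univ_succ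
      (fun j => (m j : ℤ) - (n j : ℤ)), shiftOp_fourierLp, smul_smul, ← Complex.exp_add,
      wordPhase_succ]
    congr 2
    push_cast
    ring

theorem vacuumState_mesoWord {r : ℕ} (α : Fin r → ℝ) (m n : Fin r → ℕ) :
    vacuumState (mesoWord α m n) =
      if ∑ j, m j = ∑ j, n j then Complex.exp (Complex.I * wordPhase α m n) else 0 := by
  rw [vacuumState_apply, mesoWord_vacuum, inner_smul_right, vacuum, inner_fourierLp]
  have : (0 = ∑ j, ((m j : ℤ) - (n j : ℤ))) ↔ ∑ j, m j = ∑ j, n j := by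
    rw [Finset.sum_sub_distrib, eq_comm, sub_eq_zero]
    exact_mod_cast Iff.rfl
  simp only [this, mul_ite, mul_one, mul_zero]

theorem isState_vacuumState : IsState vacuumState := by
  have h : ∀ X : heisenberg, vacuumState (star X * X) =
      inner ℂ ((X : L2Circle →L[ℂ] L2Circle) vacuum) ((X : L2Circle →L[ℂ] L2Circle) vacuum) := by
    intro X
    rw [← ContinuousLinearMap.adjoint_inner_right, ← ContinuousLinearMap.star_eq_adjoint]
    rfl
  refine ⟨fun X => ?_, fun X => ?_, ?_⟩
  · rw [h]; exact inner_self_nonneg (𝕜 := ℂ)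
  · rw [h]; exact inner_self_im (𝕜 := ℂ) _
  · change inner ℂ vacuum vacuum = (1 : ℂ)
    rw [vacuum, inner_fourierLp, if_pos rfl]

/-! ### The words span a dense subspace -/

/-- A shift is a letter with trivial phase factor, and a phase is a letter with `α = 0` whose
integer is split into positive and negative parts. -/
theorem mem_closure_exists_mesoWord {x : L2Circle →L[ℂ] L2Circle}
    (hx : x ∈ Submonoid.closure (Set.range shiftOp ∪ Set.range phaseOp)) :
    ∃ (r : ℕ) (α : Fin r → ℝ) (m n : Fin r → ℕ), (mesoWord α m n : L2Circle →L[ℂ] L2Circle) = x := by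
  induction hx using Submonoid.closure_induction_left with
  | one => exact ⟨0, Fin.elim0, Fin.elim0, Fin.elim0, rfl⟩
  | mul_left g hg y _ ih =>
    obtain ⟨r, α, m, n, rfl⟩ := ih
    rcases hg with ⟨a, rfl⟩ | ⟨k, rfl⟩
    · refine ⟨r + 1, Fin.cons a α, Fin.cons 0 m, Fin.cons 0 n, ?_⟩
      rw [mesoWord_succ]
      change shiftOp a * phaseOp ((0 : ℕ) - (0 : ℕ) : ℤ) * _ = _
      rw [Nat.cast_zero, sub_zero, phaseOp_zero, mul_one]
      rfl
    · refine ⟨r + 1, Fin.cons 0 α, Fin.cons k.toNat m, Fin.cons (-k).toNat n, ?_⟩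
      rw [mesoWord_succ]
      change shiftOp 0 * phaseOp (k.toNat - (-k).toNat : ℤ) * _ = _
      rw [Int.toNat_sub_toNat_neg, shiftOp_zero, one_mul]
      rfl

/-- The generators are closed under adjoints, so the generated star algebra is the linear span of
their products, which are words. The kernel of the difference is closed and contains this dense
subspace. -/
theorem eq_of_eq_on_mesoWord {ω₁ ω₂ : heisenberg →L[ℂ] ℂ}
    (h : ∀ (r : ℕ) (α : Fin r → ℝ) (m n : Fin r → ℕ),
      ω₁ (mesoWord α m n) = ω₂ (mesoWord α m n)) : ω₁ = ω₂ := by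
  set S : Set (L2Circle →L[ℂ] L2Circle) := Set.range shiftOp ∪ Set.range phaseOp with hS
  set K : Submodule ℂ heisenberg := LinearMap.ker (ω₁ - ω₂).toLinearMap with hK
  have hKclosed : IsClosed (K : Set heisenberg) := (ω₁ - ω₂).isClosed_ker
  have hstar : S ∪ star S = S := by
    apply Set.union_eq_self_of_subset_right
    rintro x hx
    rcases hx with ⟨a, ha⟩ | ⟨k, hk⟩
    · exact Or.inl ⟨-a, by rw [← star_shiftOp, ha, star_star]⟩
    · exact Or.inr ⟨-k, by rw [← star_phaseOp, hk, star_star]⟩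
  have hsub : ((StarAlgebra.adjoin ℂ S : StarSubalgebra ℂ (L2Circle →L[ℂ] L2Circle)) :
      Set (L2Circle →L[ℂ] L2Circle)) ⊆ Subtype.val '' (K : Set heisenberg) := by
    intro x hx
    have hx1 : x ∈ (StarAlgebra.adjoin ℂ S).toSubalgebra := hx
    rw [StarAlgebra.adjoin_toSubalgebra, hstar, ← Subalgebra.mem_toSubmodule,
      Algebra.adjoin_eq_span] at hx1
    have hle : Submodule.span ℂ (Submonoid.closure S : Set (L2Circle →L[ℂ] L2Circle)) ≤
        K.map heisenberg.toSubalgebra.toSubmodule.subtype := by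
      rw [Submodule.span_le]
      intro y hy
      obtain ⟨r, α, m, n, rfl⟩ := mem_closure_exists_mesoWord hy
      refine ⟨mesoWord α m n, ?_, rfl⟩
      change (ω₁ - ω₂) (mesoWord α m n) = 0
      rw [sub_apply, h, sub_self]
    obtain ⟨y, hy, rfl⟩ := hle hx1
    exact ⟨y, hy, rfl⟩
  ext X
  have hX : X ∈ closure (K : Set heisenberg) := by
    rw [closure_subtype]
    exact closure_mono hsub X.2
  rw [hKclosed.closure_eq] at hX
  exact sub_eq_zero.1 (show (ω₁ - ω₂) X = 0 from hX)

/-! ### Words in the rescaled ladder operators -/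

/-- `S_+ / N`. -/
def ladderPlus (N : ℕ) : Op N := ((N : ℝ)⁻¹ : ℂ) • Splus N

/-- `S_- / N`. -/
def ladderMinus (N : ℕ) : Op N := ((N : ℝ)⁻¹ : ℂ) • Sminus N

/-- The ordered product `∏ⱼ (S_- / N)^{nⱼ} (S_+ / N)^{mⱼ}`. -/
def ladderWord (N : ℕ) {r : ℕ} (m n : Fin r → ℕ) : Op N :=
  (List.ofFn fun j => ladderMinus N ^ n j * ladderPlus N ^ m j).prod

theorem ladderWord_succ (N : ℕ) {r : ℕ} (m n : Fin (r + 1) → ℕ) :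
    ladderWord N m n = ladderMinus N ^ n 0 * ladderPlus N ^ m 0 *
      ladderWord N (fun j => m j.succ) (fun j => n j.succ) := by
  simp only [ladderWord, List.ofFn_succ, List.prod_cons]

namespace IsWeightVec

variable {N : ℕ} {c m : ℝ} {v : Config N → ℂ}

theorem smul (h : IsWeightVec c m v) (z : ℂ) : IsWeightVec c m (z • v) :=
  ⟨by rw [Matrix.mulVec_smul, h.1, smul_comm], by rw [Matrix.mulVec_smul, h.2, smul_comm]⟩

theorem ladderPlus (h : IsWeightVec c m v) : IsWeightVec c (m + 1) (ladderPlus N *ᵥ v) := by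
  rw [QuasiSpin.ladderPlus, Matrix.smul_mulVec]
  exact h.splus.smul _

theorem ladderMinus (h : IsWeightVec c m v) : IsWeightVec c (m - 1) (ladderMinus N *ᵥ v) := by
  rw [QuasiSpin.ladderMinus, Matrix.smul_mulVec]
  exact h.sminus.smul _

theorem ladderPlus_pow (h : IsWeightVec c m v) (d : ℕ) :
    IsWeightVec c (m + d) (QuasiSpin.ladderPlus N ^ d *ᵥ v) := by
  induction d with
  | zero => simpa using h
  | succ d ih =>
    rw [pow_succ', ← Matrix.mulVec_mulVec, Nat.cast_succ, ← add_assoc]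
    exact ih.ladderPlus

theorem ladderMinus_pow (h : IsWeightVec c m v) (d : ℕ) :
    IsWeightVec c (m - d) (QuasiSpin.ladderMinus N ^ d *ᵥ v) := by
  induction d with
  | zero => simpa using h
  | succ d ih =>
    rw [pow_succ', ← Matrix.mulVec_mulVec, Nat.cast_succ, ← sub_sub]
    exact ih.ladderMinus

theorem ladderWord (h : IsWeightVec c m v) {r : ℕ} (p q : Fin r → ℕ) :
    IsWeightVec c (m + ∑ j, ((p j : ℝ) - q j)) (QuasiSpin.ladderWord N p q *ᵥ v) := by
  induction r with
  | zero => simpa [QuasiSpin.ladderWord] using h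
  | succ r ih =>
    rw [ladderWord_succ, ← Matrix.mulVec_mulVec, ← Matrix.mulVec_mulVec, Fin.sum_univ_succ]
    have := ((ih (fun j => p j.succ) (fun j => q j.succ)).ladderPlus_pow (p 0)).ladderMinus_pow (q 0)
    convert this using 1
    ring

theorem ladderPlus_ladderMinus (h : IsWeightVec c m v) :
    QuasiSpin.ladderPlus N *ᵥ (QuasiSpin.ladderMinus N *ᵥ v) =
      ((pairing c m / N ^ 2 : ℝ) : ℂ) • v := by
  rw [QuasiSpin.ladderPlus, QuasiSpin.ladderMinus, Matrix.smul_mulVec, Matrix.smul_mulVec,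
    Matrix.mulVec_smul, h.splus_sminus, smul_smul, smul_smul, pairing]
  congr 1
  push_cast
  ring

theorem ladderMinus_ladderPlus (h : IsWeightVec c m v) :
    QuasiSpin.ladderMinus N *ᵥ (QuasiSpin.ladderPlus N *ᵥ v) =
      ((pairing c (m + 1) / N ^ 2 : ℝ) : ℂ) • v := by
  rw [QuasiSpin.ladderPlus, QuasiSpin.ladderMinus, Matrix.smul_mulVec, Matrix.smul_mulVec,
    Matrix.mulVec_smul, h.sminus_splus, smul_smul, smul_smul, pairing]
  congr 1
  push_cast
  ring

end IsWeightVec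

/-- On joint eigenvectors the operators `M N` act, up to errors of order `1 / N` in the scalar, as
a monomial with `p` raising and `q` lowering operators. -/
def NearMonomial (p q : ℕ) (M : (N : ℕ) → Op N) : Prop :=
  ∃ K : ℝ, 0 ≤ K ∧ ∀ N : ℕ, 0 < N → ∀ (c m : ℝ) (v : Config N → ℂ), IsWeightVec c m v →
    |m| ≤ N → 0 ≤ pairing c m / N ^ 2 → pairing c m / N ^ 2 ≤ 1 →
    ∃ g : ℝ, |g - (pairing c m / N ^ 2) ^ min p q| ≤ K / N ∧
      M N *ᵥ v = (g : ℂ) • (ladderPlus N ^ (p - q) *ᵥ (ladderMinus N ^ (q - p) *ᵥ v))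

theorem abs_mul_sub_pow_succ_le {N : ℕ} (hN : 0 < N) {g f X K C : ℝ} {k : ℕ} (hC : 0 ≤ C)
    (hX0 : 0 ≤ X) (hX1 : X ≤ 1) (hg : |g - X ^ k| ≤ K / N) (hf : |f - X| ≤ C / N) :
    |g * f - X ^ (k + 1)| ≤ (K * (1 + C) + C) / N := by
  have hN' : (1 : ℝ) ≤ N := by exact_mod_cast hN
  have hCN : C / N ≤ C := div_le_self hC hN'
  have hf1 : |f| ≤ 1 + C := by
    have := abs_le.1 hf
    rw [abs_le]; constructor <;> linarith
  have hXk : |X ^ k| ≤ 1 := by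
    rw [abs_of_nonneg (pow_nonneg hX0 k)]; exact pow_le_one₀ hX0 hX1
  calc |g * f - X ^ (k + 1)| = |(g - X ^ k) * f + X ^ k * (f - X)| := by congr 1; ring
    _ ≤ |g - X ^ k| * |f| + |X ^ k| * |f - X| := by
        rw [← abs_mul, ← abs_mul]; exact abs_add_le _ _
    _ ≤ K / N * (1 + C) + 1 * (C / N) := by
        have : 0 ≤ K / N := (abs_nonneg _).trans hg
        gcongr
    _ = _ := by ring

/-- The pairing is quadratic in `m`, so a bounded shift at `|m| ≤ N` changes it by `O(N)`, which is
`O(1/N)` after division by `N²`. -/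
theorem abs_pairing_sub_le {N : ℕ} (hN : 0 < N) {c m x : ℝ} {d : ℕ} (hm : |m| ≤ N)
    (hx : |x| ≤ d) :
    |pairing c (m + x) / N ^ 2 - pairing c m / N ^ 2| ≤ (d ^ 2 + 3 * d) / N := by
  have hN' : (1 : ℝ) ≤ N := by exact_mod_cast hN
  have e : pairing c (m + x) / N ^ 2 - pairing c m / N ^ 2 = (-(2 * (m * x)) - x ^ 2 + x) / N ^ 2 := by
    rw [pairing, pairing]; ring
  rw [e, abs_div, abs_of_pos (by positivity : (0 : ℝ) < (N : ℝ) ^ 2),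
    div_le_div_iff₀ (by positivity) (by positivity)]
  have h1 : |m * x| ≤ N * d := by rw [abs_mul]; gcongr
  have h2 : x ^ 2 ≤ d ^ 2 := sq_le_sq.2 (by simpa using hx)
  have h3 : |(-(2 * (m * x)) - x ^ 2 + x)| ≤ 2 * ((N : ℝ) * d) + (d : ℝ) ^ 2 + d := by
    have h1' := abs_le.1 h1
    have hx' := abs_le.1 hx
    rw [abs_le]
    constructor <;> nlinarith [sq_nonneg x]
  have h4 : 2 * ((N : ℝ) * d) + (d : ℝ) ^ 2 + d ≤ ((d : ℝ) ^ 2 + 3 * d) * N := by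
    have hd : (0 : ℝ) ≤ d := Nat.cast_nonneg d
    nlinarith [mul_nonneg (sq_nonneg (d : ℝ)) (sub_nonneg.2 hN'), mul_nonneg hd (sub_nonneg.2 hN')]
  calc _ ≤ (2 * ((N : ℝ) * d) + (d : ℝ) ^ 2 + d) * N := by gcongr
    _ ≤ ((d : ℝ) ^ 2 + 3 * d) * N * N := by gcongr
    _ = _ := by ring

namespace NearMonomial

variable {p q : ℕ} {M : (N : ℕ) → Op N}

theorem one : NearMonomial 0 0 fun _ => 1 :=
  ⟨0, le_rfl, fun N _ c m v _ _ _ _ => ⟨1, by simp, by simp⟩⟩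

/-- If raising operators are in the majority, the power simply grows. Otherwise the new one meets a
lowering operator, and the pair acts as the pairing density at a shifted weight. -/
theorem plus (h : NearMonomial p q M) : NearMonomial (p + 1) q fun N => ladderPlus N * M N := by
  obtain ⟨K, hK, h⟩ := h
  rcases le_or_gt q p with hqp | hpq
  · refine ⟨K, hK, fun N hN c m v hv hm h0 h1 => ?_⟩
    obtain ⟨g, hg, hMv⟩ := h N hN c m v hv hm h0 h1
    refine ⟨g, ?_, ?_⟩
    · rw [min_eq_right hqp] at hg
      rwa [min_eq_right (show q ≤ p + 1 by omega)]
    · rw [← Matrix.mulVec_mulVec, hMv, Matrix.mulVec_smul, show p + 1 - q = p - q + 1 by omega,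
        show q - (p + 1) = q - p by omega, pow_succ', Matrix.mulVec_mulVec]
  -- One lowering operator is consumed; the other `d` have already moved the weight to `m - d`.
  · obtain ⟨d, hd⟩ : ∃ d, q - p = d + 1 := ⟨q - p - 1, by omega⟩
    set C : ℝ := (d : ℝ) ^ 2 + 3 * d with hC
    refine ⟨K * (1 + C) + C, by positivity, fun N hN c m v hv hm h0 h1 => ?_⟩
    obtain ⟨g, hg, hMv⟩ := h N hN c m v hv hm h0 h1
    rw [min_eq_left hpq.le] at hg
    refine ⟨g * (pairing c (m - d) / N ^ 2), ?_, ?_⟩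
    · rw [min_eq_left (show p + 1 ≤ q by omega)]
      exact abs_mul_sub_pow_succ_le hN (by positivity) h0 h1 hg
        (abs_pairing_sub_le hN hm (x := -(d : ℝ)) (by simp))
    · rw [← Matrix.mulVec_mulVec, hMv, Matrix.mulVec_smul, show p + 1 - q = 0 by omega,
        show q - (p + 1) = d by omega, show p - q = 0 by omega, hd, pow_zero, Matrix.one_mulVec,
        Matrix.one_mulVec, pow_succ', ← Matrix.mulVec_mulVec,
        (hv.ladderMinus_pow d).ladderPlus_ladderMinus, smul_smul]
      push_cast
      rfl

theorem minus (h : NearMonomial p q M) : NearMonomial p (q + 1) fun N => ladderMinus N * M N := by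
  obtain ⟨K, hK, h⟩ := h
  rcases le_or_gt p q with hpq | hqp
  · refine ⟨K, hK, fun N hN c m v hv hm h0 h1 => ?_⟩
    obtain ⟨g, hg, hMv⟩ := h N hN c m v hv hm h0 h1
    refine ⟨g, ?_, ?_⟩
    · rw [min_eq_left hpq] at hg
      rwa [min_eq_left (show p ≤ q + 1 by omega)]
    · rw [← Matrix.mulVec_mulVec, hMv, Matrix.mulVec_smul, show q + 1 - p = q - p + 1 by omega,
        show p - (q + 1) = 0 by omega, show p - q = 0 by omega, pow_zero, Matrix.one_mulVec,
        Matrix.one_mulVec, pow_succ', Matrix.mulVec_mulVec]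
  · obtain ⟨d, hd⟩ : ∃ d, p - q = d + 1 := ⟨p - q - 1, by omega⟩
    -- The shift is `d + 1` rather than `d`: on weight `m + d`, the product `S_- S_+` has the
    -- eigenvalue `pairing c (m + d + 1)`.
    set C : ℝ := ((d + 1 : ℕ) : ℝ) ^ 2 + 3 * ((d + 1 : ℕ) : ℝ) with hC
    refine ⟨K * (1 + C) + C, by positivity, fun N hN c m v hv hm h0 h1 => ?_⟩
    obtain ⟨g, hg, hMv⟩ := h N hN c m v hv hm h0 h1
    rw [min_eq_right hqp.le] at hg
    refine ⟨g * (pairing c (m + d + 1) / N ^ 2), ?_, ?_⟩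
    · rw [min_eq_right (show q + 1 ≤ p by omega), add_assoc]
      exact abs_mul_sub_pow_succ_le hN (by positivity) h0 h1 hg
        (abs_pairing_sub_le hN hm (x := (d : ℝ) + 1)
          (by rw [abs_of_nonneg (by positivity)]; push_cast; exact le_rfl))
    · rw [← Matrix.mulVec_mulVec, hMv, Matrix.mulVec_smul, show q + 1 - p = 0 by omega,
        show p - (q + 1) = d by omega, show q - p = 0 by omega, hd, pow_zero, Matrix.one_mulVec,
        pow_succ', ← Matrix.mulVec_mulVec,
        (hv.ladderPlus_pow d).ladderMinus_ladderPlus, smul_smul]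
      push_cast
      rfl

theorem plus_pow (h : NearMonomial p q M) (d : ℕ) :
    NearMonomial (p + d) q fun N => ladderPlus N ^ d * M N := by
  induction d with
  | zero => simpa using h
  | succ d ih =>
    rw [← add_assoc]
    simpa only [pow_succ', mul_assoc] using ih.plus

theorem minus_pow (h : NearMonomial p q M) (d : ℕ) :
    NearMonomial p (q + d) fun N => ladderMinus N ^ d * M N := by
  induction d with
  | zero => simpa using h
  | succ d ih =>
    rw [← add_assoc]
    simpa only [pow_succ', mul_assoc] using ih.minus

theorem ladderWord {r : ℕ} (m n : Fin r → ℕ) :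
    NearMonomial (∑ j, m j) (∑ j, n j) fun N => QuasiSpin.ladderWord N m n := by
  induction r with
  | zero => simpa [QuasiSpin.ladderWord] using one
  | succ r ih =>
    have := ((ih (fun j => m j.succ) (fun j => n j.succ)).plus_pow (m 0)).minus_pow (n 0)
    simp only [ladderWord_succ, Fin.sum_univ_succ, mul_assoc]
    rwa [add_comm (m 0), add_comm (n 0)]

end NearMonomial

namespace IsWeightBasis

variable {N : ℕ} {ι : Type*} [Fintype ι]
  {b : OrthonormalBasis ι ℂ (EuclideanSpace ℂ (Config N))} {c m : ι → ℝ}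

theorem pairing_div_nonneg (h : IsWeightBasis b c m) (i : ι) :
    0 ≤ pairing (c i) (m i) / N ^ 2 :=
  div_nonneg (h.casimir_add_nonneg i) (by positivity)

theorem pairing_div_le_one (h : IsWeightBasis b c m) (hN : 0 < N) (i : ι) :
    pairing (c i) (m i) / N ^ 2 ≤ 1 := by
  have hN' : (1 : ℝ) ≤ N := by exact_mod_cast hN
  rw [div_le_one (by positivity), pairing]
  nlinarith [h.casimir_le i, sq_nonneg (m i - 1 / 2)]

theorem dotProduct_ladderWord_eq_zero (h : IsWeightBasis b c m) {r : ℕ} {p q : Fin r → ℕ}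
    (hpq : ∑ j, p j ≠ ∑ j, q j) (i : ι) :
    star (b i).ofLp ⬝ᵥ (ladderWord N p q *ᵥ (b i).ofLp) = 0 := by
  by_contra hne
  have := eigenvalue_eq_of_dotProduct_ne_zero (Sz_conjTranspose N) (h i).2
    ((h i).ladderWord p q).2 hne
  rw [left_eq_add, Finset.sum_sub_distrib, sub_eq_zero] at this
  exact hpq (by exact_mod_cast this)

end IsWeightBasis

theorem exists_dotProduct_ladderWord_le {r : ℕ} {p q : Fin r → ℕ} (hpq : ∑ j, p j = ∑ j, q j) :
    ∃ K : ℝ, ∀ N : ℕ, 0 < N → ∀ {ι : Type} [Fintype ι]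
      (b : OrthonormalBasis ι ℂ (EuclideanSpace ℂ (Config N))) (c m : ι → ℝ),
      IsWeightBasis b c m → ∀ i, ∃ g : ℝ,
        |g - (pairing (c i) (m i) / N ^ 2) ^ (∑ j, p j)| ≤ K / N ∧
        star (b i).ofLp ⬝ᵥ (ladderWord N p q *ᵥ (b i).ofLp) = g := by
  obtain ⟨K, -, hK⟩ := NearMonomial.ladderWord p q
  refine ⟨K, fun N hN ι _ b c m h i => ?_⟩
  have hm : |m i| ≤ N := (h.abs_m_le i).trans (half_le_self (Nat.cast_nonneg N))
  obtain ⟨g, hg, hv⟩ := hK N hN (c i) (m i) _ (h i) hm (h.pairing_div_nonneg i)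
    (h.pairing_div_le_one hN i)
  rw [← hpq, min_self] at hg
  refine ⟨g, hg, ?_⟩
  rw [hv, hpq, Nat.sub_self, pow_zero, pow_zero, Matrix.one_mulVec, Matrix.one_mulVec,
    dotProduct_smul, basis_dotProduct_self, smul_eq_mul, mul_one]

/-! ### Exponentials on eigenvectors -/

theorem exp_mulVec_of_eigenvector {n : Type*} [Fintype n] [DecidableEq n] {M : Matrix n n ℂ}
    {v : n → ℂ} {μ : ℂ} (h : M *ᵥ v = μ • v) :
    NormedSpace.exp M *ᵥ v = Complex.exp μ • v := by
  -- Any algebra norm serves; it is needed only for the convergence of the exponential series.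
  let _ : NormedRing (Matrix n n ℂ) := Matrix.linftyOpNormedRing
  let _ : NormedAlgebra ℂ (Matrix n n ℂ) := Matrix.linftyOpNormedAlgebra
  have hpow : ∀ k : ℕ, M ^ k *ᵥ v = μ ^ k • v := by
    intro k
    induction k with
    | zero => simp
    | succ k ih => rw [pow_succ, ← Matrix.mulVec_mulVec, h, Matrix.mulVec_smul, ih, smul_smul,
        pow_succ']
  have h1 := NormedSpace.exp_series_hasSum_exp' (𝕂 := ℂ) M
  have h2 := h1.map (⟨⟨fun A : Matrix n n ℂ => A *ᵥ v, Matrix.zero_mulVec v⟩,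
    fun A B => Matrix.add_mulVec A B v⟩ : Matrix n n ℂ →+ (n → ℂ))
    (by
      change Continuous fun A : Matrix n n ℂ => A *ᵥ v
      fun_prop)
  have h3 := (NormedSpace.exp_series_hasSum_exp' (𝕂 := ℂ) μ).smul_const v
  rw [← Complex.exp_eq_exp_ℂ] at h3
  refine h2.unique ?_
  convert h3 using 1
  funext k
  change ((k.factorial : ℂ)⁻¹ • M ^ k) *ᵥ v = _
  rw [Matrix.smul_mulVec, hpow, smul_assoc]

/-! ### Product vectors in the doubled space -/

section Doubled

variable {n : Type*}

/-- The product vector `v ⊗ w`. -/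
def tensor (v w : n → ℂ) : n × n → ℂ := fun x => v x.1 * w x.2

theorem kronecker_mulVec_tensor [Fintype n] (A B : Matrix n n ℂ) (v w : n → ℂ) :
    (A ⊗ₖ B) *ᵥ tensor v w = tensor (A *ᵥ v) (B *ᵥ w) := by
  funext x
  simp only [Matrix.mulVec, dotProduct, tensor, Matrix.kroneckerMap_apply, Fintype.sum_prod_type,
    Finset.sum_mul_sum]
  refine Finset.sum_congr rfl fun i _ => Finset.sum_congr rfl fun j _ => ?_
  ring

theorem tensor_smul_left (z : ℂ) (v w : n → ℂ) : tensor (z • v) w = z • tensor v w := by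
  funext x; simp [tensor, mul_assoc]

theorem tensor_smul_right (z : ℂ) (v w : n → ℂ) : tensor v (z • w) = z • tensor v w := by
  funext x; simp [tensor, mul_left_comm]

theorem star_tensor_dotProduct [Fintype n] (v w v' w' : n → ℂ) :
    star (tensor v w) ⬝ᵥ tensor v' w' = (star v ⬝ᵥ v') * (star w ⬝ᵥ w') := by
  simp only [dotProduct, tensor, Fintype.sum_prod_type, Finset.sum_mul_sum, Pi.star_apply,
    star_mul']
  refine Finset.sum_congr rfl fun i _ => Finset.sum_congr rfl fun j _ => ?_
  ring

end Doubled

theorem momentum_mulVec_tensor {N : ℕ} {v w : Config N → ℂ} {μ ν : ℝ}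
    (hv : Sz N *ᵥ v = (μ : ℂ) • v) (hw : Sz N *ᵥ w = (ν : ℂ) • w) :
    momentum N *ᵥ tensor v w = ((μ : ℂ) - ν) • tensor v w := by
  rw [momentum, Matrix.sub_mulVec, kronecker_mulVec_tensor, kronecker_mulVec_tensor, hv, hw,
    Matrix.one_mulVec, Matrix.one_mulVec, tensor_smul_left, tensor_smul_right, sub_smul]

theorem Eplus_pow_mulVec_tensor (Δ : ℝ) (N k : ℕ) (v w : Config N → ℂ) :
    Eplus Δ N ^ k *ᵥ tensor v w = ((Δ : ℂ)⁻¹ ^ k) • tensor (ladderPlus N ^ k *ᵥ v) w := by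
  induction k with
  | zero => simp
  | succ k ih =>
    rw [pow_succ', ← Matrix.mulVec_mulVec, ih, Matrix.mulVec_smul, Eplus, Matrix.smul_mulVec,
      kronecker_mulVec_tensor, Matrix.one_mulVec, smul_smul, pow_succ' (ladderPlus N),
      ← Matrix.mulVec_mulVec, ladderPlus, Matrix.smul_mulVec, tensor_smul_left, smul_smul]
    congr 1
    push_cast
    rw [mul_inv]
    ring

theorem Eminus_pow_mulVec_tensor (Δ : ℝ) (N k : ℕ) (v w : Config N → ℂ) :
    Eminus Δ N ^ k *ᵥ tensor v w = ((Δ : ℂ)⁻¹ ^ k) • tensor (ladderMinus N ^ k *ᵥ v) w := by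
  induction k with
  | zero => simp
  | succ k ih =>
    rw [pow_succ', ← Matrix.mulVec_mulVec, ih, Matrix.mulVec_smul, Eminus, Matrix.smul_mulVec,
      kronecker_mulVec_tensor, Matrix.one_mulVec, smul_smul, pow_succ' (ladderMinus N),
      ← Matrix.mulVec_mulVec, ladderMinus, Matrix.smul_mulVec, tensor_smul_left, smul_smul]
    congr 1
    push_cast
    rw [mul_inv]
    ring

/-- The ladder operators leave the second factor alone, so `p` measures exactly the change of `S_z`
they have produced in the first. The phases are therefore exact at finite `N`. -/
theorem microWord_mulVec_tensor (Δ : ℝ) {N : ℕ} {c μ : ℝ} {v : Config N → ℂ}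
    (hv : IsWeightVec c μ v) {r : ℕ} (α : Fin r → ℝ) (m n : Fin r → ℕ) :
    microWord Δ N α m n *ᵥ tensor v v =
      (Complex.exp (Complex.I * wordPhase α m n) * (Δ : ℂ)⁻¹ ^ (∑ j, m j + ∑ j, n j)) •
        tensor (ladderWord N m n *ᵥ v) v := by
  induction r with
  | zero => simp [microWord, ladderWord, wordPhase]
  | succ r ih =>
    set α' : Fin r → ℝ := fun j => α j.succ
    set m' : Fin r → ℕ := fun j => m j.succ
    set n' : Fin r → ℕ := fun j => n j.succ
    have e : microWord Δ N α m n =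
        NormedSpace.exp ((Complex.I * (α 0 : ℂ)) • momentum N) * Eminus Δ N ^ n 0 *
          Eplus Δ N ^ m 0 * microWord Δ N α' m' n' := by
      simp only [microWord, List.ofFn_succ, List.prod_cons, α', m', n']
    have hw := hv.ladderWord m n
    have hexp := exp_mulVec_of_eigenvector (M := (Complex.I * (α 0 : ℂ)) • momentum N)
      (v := tensor (ladderWord N m n *ᵥ v) v)
      (μ := Complex.I * (α 0 * ∑ j, ((m j : ℂ) - (n j : ℂ)))) (by
        rw [Matrix.smul_mulVec, momentum_mulVec_tensor hw.2 hv.2, smul_smul]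
        congr 1
        push_cast
        ring)
    rw [e, ← Matrix.mulVec_mulVec, ih, Matrix.mulVec_smul, ← Matrix.mulVec_mulVec,
      Eplus_pow_mulVec_tensor, Matrix.mulVec_smul, ← Matrix.mulVec_mulVec,
      Eminus_pow_mulVec_tensor, Matrix.mulVec_smul, Matrix.mulVec_mulVec, Matrix.mulVec_mulVec,
      ← ladderWord_succ, hexp, smul_smul, smul_smul, smul_smul]
    congr 1
    rw [wordPhase_succ, mul_add, Complex.exp_add, Fin.sum_univ_succ (fun j => m j),
      Fin.sum_univ_succ (fun j => n j)]
    ring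

/-! ### Gibbs and purified expectations as sums over the spectrum -/

namespace IsWeightBasis

variable {N : ℕ} {b : OrthonormalBasis (Fin (2 ^ N)) ℂ (EuclideanSpace ℂ (Config N))}
  {c m : Fin (2 ^ N) → ℝ}

theorem exp_hamiltonian_mulVec (h : IsWeightBasis b c m) (ε Tc β : ℝ) (i : Fin (2 ^ N)) :
    NormedSpace.exp ((-β : ℂ) • hamiltonian ε Tc N) *ᵥ (b i).ofLp =
      (boltzmann N (2 * β * ε) (2 * β * Tc) (c i) (m i) : ℂ) • (b i).ofLp := by
  rw [boltzmann, Complex.ofReal_exp]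
  apply exp_mulVec_of_eigenvector
  rw [hamiltonian, Matrix.smul_mulVec, Matrix.sub_mulVec, Matrix.smul_mulVec, Matrix.smul_mulVec,
    ← Matrix.mulVec_mulVec, (h i).splus_sminus, (h i).2, smul_smul, smul_smul, ← sub_smul,
    smul_smul, pairing]
  congr 1
  push_cast
  ring

theorem trace_exp_hamiltonian (h : IsWeightBasis b c m) (ε Tc β : ℝ) :
    (NormedSpace.exp ((-β : ℂ) • hamiltonian ε Tc N)).trace =
      (partitionFn N (2 * β * ε) (2 * β * Tc) c m : ℂ) := by
  rw [trace_eq_sum_basis b, partitionFn, Complex.ofReal_sum]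
  refine Finset.sum_congr rfl fun i _ => ?_
  rw [h.exp_hamiltonian_mulVec, dotProduct_smul, basis_dotProduct_self, smul_eq_mul, mul_one]

theorem gibbs_mulVec (h : IsWeightBasis b c m) (ε Tc β : ℝ) (i : Fin (2 ^ N)) :
    gibbs ε Tc β N *ᵥ (b i).ofLp =
      (prob N (2 * β * ε) (2 * β * Tc) c m i : ℂ) • (b i).ofLp := by
  rw [gibbs, Matrix.smul_mulVec, h.exp_hamiltonian_mulVec, h.trace_exp_hamiltonian, smul_smul, prob]
  congr 1
  push_cast
  rw [div_eq_inv_mul]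

theorem weight_eq (h : IsWeightBasis b c m) (ε Tc β : ℝ) (i : Fin (2 ^ N)) :
    weight ε Tc β b i = prob N (2 * β * ε) (2 * β * Tc) c m i := by
  rw [weight, h.gibbs_mulVec, dotProduct_smul, basis_dotProduct_self, smul_eq_mul, mul_one,
    Complex.ofReal_re]

theorem gibbsExp_pairing (h : IsWeightBasis b c m) (ε Tc β : ℝ) :
    gibbsExp ε Tc β N (Splus N * Sminus N) =
      ((∑ i, prob N (2 * β * ε) (2 * β * Tc) c m i * pairing (c i) (m i) : ℝ) : ℂ) := by
  rw [gibbsExp, trace_eq_sum_basis b, Complex.ofReal_sum]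
  refine Finset.sum_congr rfl fun i _ => ?_
  rw [← Matrix.mulVec_mulVec, ← Matrix.mulVec_mulVec, (h i).splus_sminus, Matrix.mulVec_smul,
    h.gibbs_mulVec, smul_smul, dotProduct_smul, basis_dotProduct_self, smul_eq_mul, mul_one, pairing]
  push_cast
  ring

/-- The word does not alter the second tensor factor beyond a scalar, so orthogonality there removes
all cross terms between different basis vectors. -/
theorem purifiedExp_microWord (h : IsWeightBasis b c m) (ε Tc β Δ : ℝ) {r : ℕ} (α : Fin r → ℝ)
    (p q : Fin r → ℕ) :
    purifiedExp ε Tc β b (microWord Δ N α p q) =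
      Complex.exp (Complex.I * wordPhase α p q) * (Δ : ℂ)⁻¹ ^ (∑ j, p j + ∑ j, q j) *
        ∑ i, (prob N (2 * β * ε) (2 * β * Tc) c m i : ℂ) *
          (star (b i).ofLp ⬝ᵥ (ladderWord N p q *ᵥ (b i).ofLp)) := by
  set w : Fin (2 ^ N) → ℝ := fun i => prob N (2 * β * ε) (2 * β * Tc) c m i with hw
  have hΨ : purified ε Tc β b = ∑ i, (√(w i) : ℂ) • tensor (b i).ofLp (b i).ofLp := by
    funext x
    simp only [purified, Finset.sum_apply, Pi.smul_apply, tensor, smul_eq_mul, h.weight_eq, hw]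
  rw [purifiedExp, hΨ, Matrix.mulVec_sum, dotProduct_sum, Finset.mul_sum]
  refine Finset.sum_congr rfl fun i _ => ?_
  rw [star_sum, sum_dotProduct, Finset.sum_eq_single i]
  · rw [Matrix.mulVec_smul, microWord_mulVec_tensor Δ (h i), star_smul, smul_dotProduct,
      dotProduct_smul, dotProduct_smul, star_tensor_dotProduct, basis_dotProduct_self]
    have hsq : (√(w i) : ℂ) * (√(w i) : ℂ) = w i := by
      exact_mod_cast Real.mul_self_sqrt (h.prob_nonneg _ _ i)
    simp only [smul_eq_mul, RCLike.star_def, Complex.conj_ofReal, mul_one]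
    rw [← hsq]
    ring
  · intro j _ hj
    rw [Matrix.mulVec_smul, microWord_mulVec_tensor Δ (h i), star_smul, smul_dotProduct,
      dotProduct_smul, dotProduct_smul, star_tensor_dotProduct, basis_dotProduct b j i, if_neg hj]
    simp
  · simp

end IsWeightBasis

theorem IsSpinBasis.exists_isWeightBasis {N : ℕ}
    {b : OrthonormalBasis (Fin (2 ^ N)) ℂ (EuclideanSpace ℂ (Config N))} (h : IsSpinBasis b) :
    ∃ c m, IsWeightBasis b c m := by
  choose s m hs using h
  exact ⟨fun i => s i * (s i + 1), m, fun i => (hs i).2⟩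

/-! ### The thermodynamic limit -/

theorem tendsto_moment {a y : ℝ} (hy : 0 < y) (ha : |a| < 2 * y)
    {b : (N : ℕ) → OrthonormalBasis (Fin (2 ^ N)) ℂ (EuclideanSpace ℂ (Config N))}
    {c m : (N : ℕ) → Fin (2 ^ N) → ℝ} (h : ∀ N, IsWeightBasis (b N) (c N) (m N)) (k : ℕ) :
    Filter.Tendsto (fun N : ℕ => ∑ i, prob N a (coupling y) (c N) (m N) i *
        (pairing (c N i) (m N i) / N ^ 2) ^ k) Filter.atTop
      (nhds (((y ^ 2 - a ^ 2 / 4) / coupling y ^ 2) ^ k)) := by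
  set D := (y ^ 2 - a ^ 2 / 4) / coupling y ^ 2 with hD
  -- A Lipschitz constant of `x ↦ x ^ k` between `D` and the pairing densities, which lie in `[0,
  -- 1]`.
  set B : ℝ := k * max 1 |D| ^ (k - 1) with hB
  have hB0 : 0 ≤ B := by positivity
  rw [Metric.tendsto_atTop']
  intro η hη
  obtain ⟨N₀, hN₀⟩ := Filter.eventually_atTop.1
    (eventually_sum_prob_abs_le hy ha (η := η / (B + 1) / 2) (by positivity))
  refine ⟨N₀, fun N hN => ?_⟩
  have hNpos : 0 < N := by omega
  have hdev := hN₀ N hN.le (b N) (c N) (m N) (h N)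
  have hdiff : (∑ i, prob N a (coupling y) (c N) (m N) i *
      (pairing (c N i) (m N i) / N ^ 2) ^ k) - D ^ k =
      ∑ i, prob N a (coupling y) (c N) (m N) i *
        ((pairing (c N i) (m N i) / N ^ 2) ^ k - D ^ k) := by
    simp only [mul_sub, Finset.sum_sub_distrib]
    rw [← Finset.sum_mul, (h N).sum_prob, one_mul]
  rw [Real.dist_eq, hdiff]
  calc _ ≤ ∑ i, prob N a (coupling y) (c N) (m N) i *
        (B * |pairing (c N i) (m N i) / N ^ 2 - D|) := by
        refine (Finset.abs_sum_le_sum_abs _ _).trans (Finset.sum_le_sum fun i _ => ?_)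
        have hp := (h N).prob_nonneg a (coupling y) i
        rw [abs_mul, abs_of_nonneg hp]
        refine mul_le_mul_of_nonneg_left ?_ hp
        refine (abs_pow_sub_pow_le _ _ k).trans ?_
        have h0 := (h N).pairing_div_nonneg i
        have h1 := (h N).pairing_div_le_one hNpos i
        rw [mul_assoc, mul_comm, hB]
        gcongr
        rwa [abs_of_nonneg h0]
    _ = B * ∑ i, prob N a (coupling y) (c N) (m N) i *
        |pairing (c N i) (m N i) / N ^ 2 - D| := by
        rw [Finset.mul_sum]
        exact Finset.sum_congr rfl fun i _ => by ring
    _ ≤ B * (η / (B + 1) / 2) := by gcongr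
    _ < η := by
        have : B * (η / (B + 1) / 2) = (B / (B + 1)) * (η / 2) := by ring
        rw [this]
        have hle : B / (B + 1) ≤ 1 := (div_le_one (by positivity)).2 (by linarith)
        calc _ ≤ 1 * (η / 2) := by gcongr
          _ < η := by linarith

/-- A balanced word acts on `bᵢ` as a power of the pairing density with error `K / N` uniform in
`i`, so the limit of the moments carries over. -/
theorem tendsto_sum_prob_ladderWord {a y : ℝ} (hy : 0 < y) (ha : |a| < 2 * y)
    {b : (N : ℕ) → OrthonormalBasis (Fin (2 ^ N)) ℂ (EuclideanSpace ℂ (Config N))}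
    {c m : (N : ℕ) → Fin (2 ^ N) → ℝ} (h : ∀ N, IsWeightBasis (b N) (c N) (m N)) {r : ℕ}
    {p q : Fin r → ℕ} (hpq : ∑ j, p j = ∑ j, q j) :
    Filter.Tendsto (fun N : ℕ => ∑ i, (prob N a (coupling y) (c N) (m N) i : ℂ) *
        (star (b N i).ofLp ⬝ᵥ (ladderWord N p q *ᵥ (b N i).ofLp))) Filter.atTop
      (nhds ((((y ^ 2 - a ^ 2 / 4) / coupling y ^ 2) ^ (∑ j, p j) : ℝ) : ℂ)) := by
  obtain ⟨K, hK⟩ := exists_dotProduct_ladderWord_le hpq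
  have hmom := (Complex.continuous_ofReal.tendsto _).comp (tendsto_moment hy ha h (∑ j, p j))
  refine tendsto_of_tendsto_of_dist hmom ?_
  have hlim : Filter.Tendsto (fun N : ℕ => K / (N : ℝ)) Filter.atTop (nhds 0) :=
    tendsto_const_div_atTop_nhds_zero_nat K
  refine squeeze_zero' (Filter.Eventually.of_forall fun _ => dist_nonneg) ?_ hlim
  filter_upwards [Filter.eventually_gt_atTop 0] with N hN
  choose g hg hgv using hK N hN (b N) (c N) (m N) (h N)
  rw [dist_comm, Function.comp_apply, dist_eq_norm, Complex.ofReal_sum, ← Finset.sum_sub_distrib]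
  refine (norm_sum_le _ _).trans ?_
  calc _ ≤ ∑ i, prob N a (coupling y) (c N) (m N) i * (K / N) := by
        refine Finset.sum_le_sum fun i _ => ?_
        have hp := (h N).prob_nonneg a (coupling y) i
        rw [hgv, ← Complex.ofReal_mul, ← Complex.ofReal_sub, ← mul_sub, Complex.norm_real,
          Real.norm_eq_abs, abs_mul, abs_of_nonneg hp]
        exact mul_le_mul_of_nonneg_left (hg i) hp
    _ = _ := by rw [← Finset.sum_mul, (h N).sum_prob, one_mul]

/-- The witness is `y = βω`: the gap equation gives `coupling (βω) = 2βT_c`, positivity of `Δ` gives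
`|ε| < ω`, and `ω² - ε² = 4T_c²Δ²` identifies the concentration point. -/
theorem IsGapModulus.exists_meanField {ε Tc β Δ : ℝ} (hTc : 0 < Tc) (hβ : 0 < β)
    (hΔ : IsGapModulus ε Tc β Δ) :
    ∃ y : ℝ, 0 < y ∧ |2 * β * ε| < 2 * y ∧ coupling y = 2 * β * Tc ∧
      (y ^ 2 - (2 * β * ε) ^ 2 / 4) / coupling y ^ 2 = Δ ^ 2 := by
  obtain ⟨hpos, hgap⟩ := hΔ
  set ω := √(ε ^ 2 + 4 * Tc ^ 2 * Δ ^ 2) with hω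
  have hsq : ω ^ 2 = ε ^ 2 + 4 * Tc ^ 2 * Δ ^ 2 := Real.sq_sqrt (by positivity)
  have hωpos : 0 < ω := Real.sqrt_pos.2 (by positivity)
  have hlt : |ε| < ω := by
    rw [hω, ← Real.sqrt_sq_eq_abs]
    exact Real.sqrt_lt_sqrt (sq_nonneg ε) (by
      have : 0 < 4 * Tc ^ 2 * Δ ^ 2 := by positivity
      linarith)
  have hc : coupling (β * ω) = 2 * β * Tc := by
    rw [coupling, ← hgap]
    field_simp
  refine ⟨β * ω, by positivity, ?_, hc, ?_⟩
  · rw [abs_mul, abs_of_pos (by positivity : 0 < 2 * β)]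
    nlinarith
  · rw [hc, mul_pow, hsq]
    field_simp
    ring

theorem tendsto_gibbsExp_pairing {ε Tc β Δ : ℝ} (hTc : 0 < Tc) (hβ : 0 < β)
    (hΔ : IsGapModulus ε Tc β Δ)
    {b : (N : ℕ) → OrthonormalBasis (Fin (2 ^ N)) ℂ (EuclideanSpace ℂ (Config N))}
    (hb : ∀ N, IsSpinBasis (b N)) :
    Filter.Tendsto (fun N : ℕ => gibbsExp ε Tc β N (Splus N * Sminus N) / (N : ℂ) ^ 2)
      Filter.atTop (nhds ((Δ : ℂ) ^ 2)) := by
  choose c m h using fun N => (hb N).exists_isWeightBasis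
  obtain ⟨y, hy, ha, hc, hD⟩ := hΔ.exists_meanField hTc hβ
  have hmom := (Complex.continuous_ofReal.tendsto _).comp (tendsto_moment hy ha h 1)
  rw [hD, pow_one, Complex.ofReal_pow] at hmom
  refine hmom.congr fun N => ?_
  rw [Function.comp_apply, (h N).gibbsExp_pairing, hc]
  simp only [pow_one, ← mul_div_assoc]
  rw [← Finset.sum_div]
  push_cast
  rfl

theorem tendsto_purifiedExp {ε Tc β Δ : ℝ} (hTc : 0 < Tc) (hβ : 0 < β)
    (hΔ : IsGapModulus ε Tc β Δ)
    {b : (N : ℕ) → OrthonormalBasis (Fin (2 ^ N)) ℂ (EuclideanSpace ℂ (Config N))}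
    (hb : ∀ N, IsSpinBasis (b N)) {r : ℕ} (α : Fin r → ℝ) (p q : Fin r → ℕ) :
    Filter.Tendsto (fun N : ℕ => purifiedExp ε Tc β (b N) (microWord Δ N α p q))
      Filter.atTop (nhds (vacuumState (mesoWord α p q))) := by
  choose c m h using fun N => (hb N).exists_isWeightBasis
  obtain ⟨y, hy, ha, hc, hD⟩ := hΔ.exists_meanField hTc hβ
  simp only [fun N => (h N).purifiedExp_microWord ε Tc β Δ α p q]
  rw [vacuumState_mesoWord]
  split_ifs with hpq
  · have hlim := tendsto_sum_prob_ladderWord hy ha h hpq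
    rw [hD, hc] at hlim
    have := hlim.const_mul (Complex.exp (Complex.I * wordPhase α p q) *
      (Δ : ℂ)⁻¹ ^ (∑ j, p j + ∑ j, q j))
    convert this using 2
    have hΔ0 : (Δ : ℂ) ≠ 0 := by exact_mod_cast hΔ.1.ne'
    -- With equally many raising and lowering operators, the normalization `Δ⁻¹` to the power `2 ∑
    -- p` cancels the limit `(Δ²) ^ ∑ p`.
    rw [← hpq, mul_assoc, ← two_mul, pow_mul]
    push_cast
    rw [← mul_pow, ← mul_pow, inv_mul_cancel₀ hΔ0, one_pow, one_pow, mul_one]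
  · refine tendsto_const_nhds.congr fun N => ?_
    simp only [(h N).dotProduct_ladderWord_eq_zero hpq, mul_zero, Finset.sum_const_zero]

end QuasiSpin

end

theorem theorem1 (ε Tc β Δ : ℝ) (hTc : 0 < Tc) (hβ : 0 < β)
    (hΔ : QuasiSpin.IsGapModulus ε Tc β Δ)
    (b : (N : ℕ) → OrthonormalBasis (Fin (2 ^ N)) ℂ (EuclideanSpace ℂ (QuasiSpin.Config N)))
    (hb : ∀ N, QuasiSpin.IsSpinBasis (b N)) :
    -- the constant `𝔠`, `𝔠² = lim ⟨S_+ S_-⟩ / N²`, is the gap modulus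
    Filter.Tendsto
      (fun N : ℕ => QuasiSpin.gibbsExp ε Tc β N (QuasiSpin.Splus N * QuasiSpin.Sminus N) /
        (N : ℂ) ^ 2)
      Filter.atTop (nhds ((Δ : ℂ) ^ 2)) ∧
    -- the limits of all correlation functions are the values of the vacuum state
    QuasiSpin.IsState QuasiSpin.vacuumState ∧
    (∀ (r : ℕ) (α : Fin r → ℝ) (m n : Fin r → ℕ),
      Filter.Tendsto
        (fun N : ℕ => QuasiSpin.purifiedExp ε Tc β (b N) (QuasiSpin.microWord Δ N α m n))
        Filter.atTop (nhds (QuasiSpin.vacuumState (QuasiSpin.mesoWord α m n))) ∧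
      QuasiSpin.vacuumState (QuasiSpin.mesoWord α m n) =
        if ∑ j, m j = ∑ j, n j then
          Complex.exp (Complex.I *
            ∑ j, ∑ k ∈ Finset.Iic j, (α k : ℂ) * ((m j : ℂ) - (n j : ℂ)))
        else 0) ∧
    -- no other state has these limits as its values
    (∀ ω : QuasiSpin.heisenberg →L[ℂ] ℂ, QuasiSpin.IsState ω →
      (∀ (r : ℕ) (α : Fin r → ℝ) (m n : Fin r → ℕ),
        Filter.Tendsto
          (fun N : ℕ => QuasiSpin.purifiedExp ε Tc β (b N) (QuasiSpin.microWord Δ N α m n))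
          Filter.atTop (nhds (ω (QuasiSpin.mesoWord α m n)))) →
      ω = QuasiSpin.vacuumState) := by
  refine ⟨QuasiSpin.tendsto_gibbsExp_pairing hTc hβ hΔ hb, QuasiSpin.isState_vacuumState,
    fun r α m n => ⟨QuasiSpin.tendsto_purifiedExp hTc hβ hΔ hb α m n,
      QuasiSpin.vacuumState_mesoWord α m n⟩, fun ω _ hω => ?_⟩
  exact QuasiSpin.eq_of_eq_on_mesoWord fun r α m n =>
    tendsto_nhds_unique (hω r α m n) (QuasiSpin.tendsto_purifiedExp hTc hβ hΔ hb α m n)
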